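/- Let $\Sigma=\{u\in H^1(\mathbb R^2;\mathbb C):\ xu\in L^2(\mathbb R^2)\}$ with norm $\|u\|_\Sigma^2=\|\nabla u\|_2^2+\|(1+|x|^2)^{1/2}u\|_2^2$, let $(u,v)_2=\int_{\mathbb R^2}u\,\bar v\,dx$, and let $\varphi_1(x)=\pi^{-1/2}e^{-|x|^2/2}$ be the ground state of $-\Delta+|x|^2$ on $\mathbb R^2$ (with eigenvalue $2$). For $\mu\in\mathbb R$ consider the stationary equation $$\mu Q=(-\Delta+|x|^2+|Q|^2)Q,\qquad Q\in\Sigma\setminus\{0\},\tag{1}$$ understood in $\Sigma^*$, i.e. tested against every $v\in\Sigma$. There are $\eta_0>0$ and functions $u,z$ with values in $L^2(\mathbb R^2;\mathbb C)$ and $\mu,a$ with values in $\mathbb R$, such that: 1. for every $0<\eta<\eta_0$, $\mu(\eta)=2+\eta>2$, $u(\eta)\in\Sigma\setminus\{0\}$ solves (1) with $\mu=\mu(\eta)$, and $$u(\eta)=\sqrt\eta\,\bigl(a(\eta)\varphi_1+z(\eta)\bigr);$$ 2. for every $0<\eta<\eta_0$ the solution is unique up to a constant phase: every solution $Q$ of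 (1) with $\mu=2+\eta$ is $Q=c\,u(\eta)$ for some $c\in\mathbb C$ with $|c|=1$; 3. $z(0)=0$, and for every $0\le\eta<\eta_0$: $a(\eta)>0$, $z(\eta)\in\Sigma$ and $(z(\eta),\varphi_1)_2=0$; 4. $a:[0,\eta_0)\to\mathbb R$ is continuous, and $z:[0,\eta_0)\to\Sigma$ is continuous for the norm of $\Sigma$. -/

import Mathlib

open MeasureTheory Set Filter Topology
open scoped SchwartzMap LineDeriv

noncomputable section

/-- The Euclidean plane. -/
abbrev Plane : Type := EuclideanSpace ℝ (Fin 2)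

/-- The space `L²(ℝ²; ℂ)`. -/
abbrev L2 : Type := Lp ℂ 2 (volume : Measure Plane)

/-- The function `g ∈ L²` is the distributional partial derivative `∂u/∂x_i` of `u ∈ L²`. -/
def HasWeakDeriv (i : Fin 2) (u g : L2) : Prop :=
  ∂_{(EuclideanSpace.single i 1 : Plane)} (u : 𝓢'(Plane, ℂ)) = (g : 𝓢'(Plane, ℂ))

theorem HasWeakDeriv.unique {i : Fin 2} {u g h : L2} (hg : HasWeakDeriv i u g)
    (hh : HasWeakDeriv i u h) : g = h := by
  have e : (g : 𝓢'(Plane, ℂ)) = (h : 𝓢'(Plane, ℂ)) := hg.symm.trans hh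
  have inj := LinearMap.ker_eq_bot.1
    (Lp.ker_toTemperedDistributionCLM_eq_bot (E := Plane) (F := ℂ) (μ := volume) (p := 2))
  exact inj e

open Classical in
/-- The partial derivative `∂u/∂x_i ∈ L²` of a function having one (and `0` otherwise). -/
def weakDeriv (i : Fin 2) (u : L2) : L2 :=
  if h : ∃ g, HasWeakDeriv i u g then h.choose else 0

theorem HasWeakDeriv.weakDeriv_eq {i : Fin 2} {u g : L2} (hg : HasWeakDeriv i u g) :
    weakDeriv i u = g := by
  have h : ∃ g, HasWeakDeriv i u g := ⟨g, hg⟩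
  rw [weakDeriv, dif_pos h]
  exact h.choose_spec.unique hg

/-- The energy space `Σ = H¹(ℝ²) ∩ {u : x u ∈ L²}`, complex-valued. -/
def MemSigma (u : L2) : Prop :=
  (∀ i, ∃ g, HasWeakDeriv i u g) ∧
    MemLp (fun x : Plane => (‖x‖ : ℂ) * u x) 2 volume

/-- The norm of `Σ`: `‖u‖² = ‖∇u‖₂² + ‖(1 + |x|²)^{1/2} u‖₂²`. -/
def sigmaNorm (u : L2) : ℝ :=
  √(∑ i, ‖weakDeriv i u‖ ^ 2 + ∫ x : Plane, (1 + ‖x‖ ^ 2) * ‖u x‖ ^ 2)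

/-- The scalar product `(u, v)₂ = ∫ u v̄`. -/
def scalar (u v : L2) : ℂ := ∫ x : Plane, u x * star (v x)

/-- `Q ∈ Σ \ {0}` solves `μ Q = (-Δ + |x|² + |Q|²) Q` in `Σ*`, i.e. in weak form, against every
`v ∈ Σ`. All integrands are integrable, since `Σ ⊆ L² ∩ L⁴` in the plane. -/
def IsStationarySol (μ : ℝ) (Q : L2) : Prop :=
  MemSigma Q ∧ Q ≠ 0 ∧ ∀ v : L2, MemSigma v →
    (μ : ℂ) * scalar Q v =
      ∑ i, scalar (weakDeriv i Q) (weakDeriv i v)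
        + (∫ x : Plane, (‖x‖ : ℂ) ^ 2 * Q x * star (v x))
        + ∫ x : Plane, (‖Q x‖ : ℂ) ^ 2 * Q x * star (v x)

/-- The Gaussian `φ₁(x) = π^{-1/2} e^{-|x|²/2}`, as a function. -/
def gaussFun (x : Plane) : ℂ := ((1 / √Real.pi * Real.exp (-‖x‖ ^ 2 / 2) : ℝ) : ℂ)

theorem memLp_gaussFun : MemLp gaussFun 2 (volume : Measure Plane) := by
  have hc : Continuous gaussFun := by unfold gaussFun; fun_prop
  rw [memLp_two_iff_integrable_sq_norm hc.aestronglyMeasurable]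
  have h := GaussianFourier.integrable_cexp_neg_mul_sq_norm_add (V := Plane) (b := 1)
    (by simp) 0 0
  have h2 := (h.norm).const_mul ((1 / √Real.pi) ^ 2)
  refine h2.congr (Eventually.of_forall fun x => ?_)
  have e : (-1 * (‖x‖ : ℂ) ^ 2 + 0 * ((inner ℝ (0 : Plane) x : ℝ) : ℂ))
      = ((-‖x‖ ^ 2 : ℝ) : ℂ) := by push_cast; ring
  simp only [gaussFun]
  rw [e, Complex.norm_exp, Complex.ofReal_re, Complex.norm_real, Real.norm_eq_abs, sq_abs, mul_pow,
    ← Real.exp_nat_mul]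
  congr 2
  push_cast
  ring

/-- The ground state `φ₁` of `-Δ + |x|²` on the plane. -/
def phi1 : L2 := memLp_gaussFun.toLp gaussFun

end

/-! Let H = -Δ + |x|². In the Hilbert norm of Σ, ‖Q‖² is the quadratic form of H + 1. Riesz
representation turns the L² pairing into an operator K and the cubic term into a map N, so for μ = 2
+ η equation (1) reads Q - 3KQ = ηKQ - N(Q), where 3 = 2 + 1 and e = φ₁ is fixed by 3K.

Existence is a Lyapunov–Schmidt reduction. Put Q = b(e + ξ) with ξ ⊥ e; by homogeneity b enters only
through |b|². The range of 1 - 3K is orthogonal to e, so pairing with e gives η = |b|²⟪e, N(e + ξ)⟫,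
that is |b|² = ηκ(ξ). What remains is ξ - 3Kξ = η(K(e + ξ) - κ(ξ)N(e + ξ)). The spectral gap makes 1
- 3K invertible on the complement of e, so this becomes ξ = ηG(ξ) with G Lipschitz near 0, and
`exists_fixedPoint_smul` yields a solution continuous in η that vanishes at η = 0. The branch has a
= √κ and z = aξ (`CubicBifurcation.exists_branch`).

Uniqueness must hold among all solutions, not only small ones near e. Testing (1) with Q bounds ‖Q‖²
by 4‖Q‖₂² and ‖Q‖₄⁴ by η‖Q‖₂². The first bound keeps most of the mass in a fixed ball, where the L⁴
norm controls it (`norm_toFn_pow_four_le`); hence ‖Q‖² = O(η), the right-hand side is O(η‖Q‖), and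
coercivity makes the part of Q orthogonal to e relatively small. Every solution thus falls in the
ball where the fixed point is unique (`exists_smul_add_of_solution`).

The gap (`exists_spectral_gap`) is a Gaussian Poincaré inequality: ψ(x)φ₁(y) and ψ(y)φ₁(x) are
joined by a rotation of (x, y), whose generator produces the annihilation operators ∂ᵢ + xᵢ applied
to ψ. The cubic term is controlled by Ladyzhenskaya's inequality (`exists_eLpNorm_four_le`). These
facts are proved for Schwartz functions and passed to Σ by density (`Sg_induction`). -/

noncomputable section

/-! ### Abstract bifurcation from a simple eigenvalue. -/

/-- A Lipschitz map on a ball, multiplied by a small parameter, has a unique fixed point there,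
depending continuously on the parameter. -/
theorem exists_fixedPoint_smul {V : Type*} [NormedAddCommGroup V] [NormedSpace ℝ V]
    [CompleteSpace V] (G : V → V) {r L : ℝ} (hr : 0 < r) (hL : 0 ≤ L)
    (hG : ∀ x y, ‖x‖ ≤ r → ‖y‖ ≤ r → ‖G x - G y‖ ≤ L * ‖x - y‖) :
    ∃ η₀ : ℝ, 0 < η₀ ∧ ∃ ξ : ℝ → V, ξ 0 = 0 ∧
      (∀ η ∈ Ico 0 η₀, ‖ξ η‖ ≤ r ∧ ξ η = η • G (ξ η) ∧
        ∀ x, ‖x‖ ≤ r → x = η • G x → x = ξ η) ∧ ContinuousOn ξ (Ico 0 η₀) := by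
  set M : ℝ := ‖G 0‖ + L * r with hM
  have hM0 : 0 ≤ M := by positivity
  have hGM : ∀ x, ‖x‖ ≤ r → ‖G x‖ ≤ M := by
    intro x hx
    have h1 := hG x 0 hx (by simpa using hr.le)
    rw [sub_zero] at h1
    have h2 : ‖G x‖ ≤ ‖G 0‖ + ‖G x - G 0‖ := by
      simpa using norm_add_le (G 0) (G x - G 0)
    have h3 : L * ‖x‖ ≤ L * r := by gcongr
    linarith
  -- The first bound maps the ball into itself, the second gives contraction factor 1/2; the added
  -- 1's allow M = 0 or L = 0.
  set η₀ : ℝ := min (r / (M + 1)) (1 / (2 * (L + 1))) with hη₀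
  have hη₀pos : 0 < η₀ := by positivity
  have key : ∀ η ∈ Ico 0 η₀, η * M ≤ r ∧ η * L ≤ 1 / 2 := by
    intro η hη
    have h1 : η ≤ r / (M + 1) := hη.2.le.trans (min_le_left _ _)
    have h2 : η ≤ 1 / (2 * (L + 1)) := hη.2.le.trans (min_le_right _ _)
    rw [le_div_iff₀ (by positivity)] at h1 h2
    have := hη.1
    constructor <;> nlinarith
  have uniq : ∀ η ∈ Ico 0 η₀, ∀ x y, ‖x‖ ≤ r → ‖y‖ ≤ r → x = η • G x → y = η • G y → x = y := by
    intro η hη x y hx hy ex ey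
    have h1 : ‖x - y‖ ≤ 1 / 2 * ‖x - y‖ := by
      calc ‖x - y‖ = ‖η • (G x - G y)‖ := by rw [smul_sub, ← ex, ← ey]
        _ = η * ‖G x - G y‖ := by rw [norm_smul, Real.norm_of_nonneg hη.1]
        _ ≤ η * (L * ‖x - y‖) := mul_le_mul_of_nonneg_left (hG x y hx hy) hη.1
        _ = (η * L) * ‖x - y‖ := by ring
        _ ≤ 1 / 2 * ‖x - y‖ := mul_le_mul_of_nonneg_right (key η hη).2 (norm_nonneg _)
    have : ‖x - y‖ = 0 := by linarith [norm_nonneg (x - y)]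
    exact sub_eq_zero.1 (norm_eq_zero.1 this)
  have ex : ∀ η ∈ Ico 0 η₀, ∃ x, ‖x‖ ≤ r ∧ x = η • G x := by
    intro η hη
    have hmaps : MapsTo (fun x => η • G x) (Metric.closedBall 0 r) (Metric.closedBall 0 r) := by
      intro x hx
      rw [mem_closedBall_zero_iff] at hx ⊢
      rw [norm_smul, Real.norm_of_nonneg hη.1]
      exact (mul_le_mul_of_nonneg_left (hGM x hx) hη.1).trans (key η hη).1
    have hc : ContractingWith (1 / 2) (hmaps.restrict _ _ _) := by
      refine ⟨by norm_num, LipschitzWith.of_dist_le_mul fun x y => ?_⟩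
      have hx := mem_closedBall_zero_iff.1 x.2
      have hy := mem_closedBall_zero_iff.1 y.2
      rw [Subtype.dist_eq, Subtype.dist_eq, dist_eq_norm, dist_eq_norm]
      simp only [MapsTo.val_restrict_apply]
      rw [← smul_sub, norm_smul, Real.norm_of_nonneg hη.1]
      calc η * ‖G x - G y‖ ≤ η * (L * ‖(x : V) - y‖) :=
            mul_le_mul_of_nonneg_left (hG x y hx hy) hη.1
        _ = (η * L) * ‖(x : V) - y‖ := by ring
        _ ≤ _ := by
          have := mul_le_mul_of_nonneg_right (key η hη).2 (norm_nonneg ((x : V) - y))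
          simpa using this
    obtain ⟨x, hx, hfix, -⟩ := hc.exists_fixedPoint' (Metric.isClosed_closedBall.isComplete) hmaps
      (x := 0) (by simpa using hr.le) (edist_ne_top _ _)
    exact ⟨x, mem_closedBall_zero_iff.1 hx, hfix.symm⟩
  choose! ξ hξr hξ using ex
  have h0 : (0 : ℝ) ∈ Ico 0 η₀ := ⟨le_rfl, hη₀pos⟩
  refine ⟨η₀, hη₀pos, ξ, ?_, fun η hη => ⟨hξr η hη, hξ η hη, fun x hx e =>
    uniq η hη x _ hx (hξr η hη) e (hξ η hη)⟩, ?_⟩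
  · rw [hξ 0 h0, zero_smul]
  · have lip : LipschitzOnWith (Real.toNNReal (2 * M)) ξ (Ico 0 η₀) := by
      refine LipschitzOnWith.of_dist_le_mul fun s hs t ht => ?_
      rw [Real.coe_toNNReal _ (by positivity), dist_eq_norm, dist_eq_norm]
      -- The first term is at most half of the left side and is absorbed, which leaves a Lipschitz
      -- bound with constant 2M.
      have e1 : ξ s - ξ t = s • (G (ξ s) - G (ξ t)) + (s - t) • G (ξ t) := by
        nth_rewrite 1 [hξ s hs, hξ t ht]
        module
      have h1 : ‖ξ s - ξ t‖ ≤ 1 / 2 * ‖ξ s - ξ t‖ + ‖s - t‖ * M := by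
        nth_rewrite 1 [e1]
        refine (norm_add_le _ _).trans (add_le_add ?_ ?_)
        · rw [norm_smul, Real.norm_of_nonneg hs.1]
          calc s * ‖G (ξ s) - G (ξ t)‖ ≤ s * (L * ‖ξ s - ξ t‖) :=
                mul_le_mul_of_nonneg_left (hG _ _ (hξr s hs) (hξr t ht)) hs.1
            _ = (s * L) * ‖ξ s - ξ t‖ := by ring
            _ ≤ _ := mul_le_mul_of_nonneg_right (key s hs).2 (norm_nonneg _)
        · rw [norm_smul]
          exact mul_le_mul_of_nonneg_left (hGM _ (hξr t ht)) (norm_nonneg _)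
      linarith
    exact lip.continuousOn

variable {V : Type*} [NormedAddCommGroup V] [InnerProductSpace ℂ V]

local notation "⟪" x ", " y "⟫" => inner ℂ x y

/-- The Hilbert space structure behind a stationary equation `Q - 3 K Q = η K Q - N Q` bifurcating
from the simple eigenvector `e` of `3 K`, with a defocusing cubic nonlinearity `N`. -/
structure CubicBifurcation (K : V →L[ℂ] V) (N : V → V) (e : V) (δ C : ℝ) : Prop where
  symm : ∀ u v, ⟪K u, v⟫ = ⟪u, K v⟫
  map_e : (3 : ℂ) • K e = e
  inner_e : ⟪e, e⟫ = 3
  delta_pos : 0 < δ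
  coercive : ∀ v, δ * ‖v‖ ^ 2 ≤ ‖v‖ ^ 2 - 3 * (⟪v, K v⟫).re + ‖⟪e, v⟫‖ ^ 2
  le_norm_sq : ∀ v, 3 * (⟪v, K v⟫).re ≤ ‖v‖ ^ 2
  C_nonneg : 0 ≤ C
  cubic_smul : ∀ (c : ℂ) w, N (c • w) = ((‖c‖ ^ 2 : ℝ) : ℂ) • c • N w
  cubic_lip : ∀ w w', ‖N w - N w'‖ ≤ C * (‖w‖ + ‖w'‖) ^ 2 * ‖w - w'‖
  cubic_self_im : ∀ w, (⟪w, N w⟫).im = 0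
  cubic_self_nonneg : ∀ w, 0 ≤ (⟪w, N w⟫).re
  cubic_e_pos : 0 < (⟪e, N e⟫).re
  apriori : ∀ w, ‖w‖ ^ 2 ≤ 4 * (⟪w, K w⟫).re → (⟪w, K w⟫).re ^ 2 ≤ C * (⟪w, N w⟫).re

namespace CubicBifurcation

variable {K : V →L[ℂ] V} {N : V → V} {e : V} {δ C : ℝ}

/-- The coefficient `1 / Re ⟪e, N (e + ξ)⟫`. -/
def coeff (N : V → V) (e ξ : V) : ℝ := ((⟪e, N (e + ξ)⟫).re)⁻¹

/-- The right-hand side `K (e + ξ) - κ(ξ) N (e + ξ)` of the reduced equation. -/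
def rhs (K : V →L[ℂ] V) (N : V → V) (e ξ : V) : V :=
  K (e + ξ) - ((coeff N e ξ : ℝ) : ℂ) • N (e + ξ)

/-- The projection onto the orthogonal complement of `e`, when `‖e‖ ^ 2 = 3`. -/
def proj (e : V) : V →L[ℂ] V :=
  ContinuousLinearMap.id ℂ V - ((3 : ℂ)⁻¹ • (innerSL ℂ e)).smulRight e

theorem proj_apply (e v : V) : proj e v = v - ((3 : ℂ)⁻¹ * ⟪e, v⟫) • e := by
  simp [proj]

/-- The coercive operator `1 - 3 K + ⟪e, ·⟫ e`. -/
def opA (K : V →L[ℂ] V) (e : V) : V →L[ℂ] V :=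
  ContinuousLinearMap.id ℂ V - (3 : ℂ) • K + (innerSL ℂ e).smulRight e

theorem opA_apply (v : V) : opA K e v = v - (3 : ℂ) • K v + ⟪e, v⟫ • e := by
  simp [opA]

variable (h : CubicBifurcation K N e δ C)

include h

theorem inner_e_map (v : V) : 3 * ⟪e, K v⟫ = ⟪e, v⟫ := by
  rw [← h.symm]
  conv_rhs => rw [← h.map_e]
  rw [inner_smul_left, Complex.conj_ofNat]

/-- Solvability condition: 3K is symmetric and fixes e, so pairing the equation with e removes its
linear left side. -/
theorem inner_e_sub (v : V) : ⟪e, v - (3 : ℂ) • K v⟫ = 0 := by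
  rw [inner_sub_right, inner_smul_right, h.inner_e_map, sub_self]

theorem inner_e_opA (v : V) : ⟪e, opA K e v⟫ = 3 * ⟪e, v⟫ := by
  rw [opA_apply, inner_add_right, h.inner_e_sub, inner_smul_right, h.inner_e]
  ring

theorem inner_e_proj (v : V) : ⟪e, proj e v⟫ = 0 := by
  rw [proj_apply, inner_sub_right, inner_smul_right, h.inner_e]
  ring

theorem norm_e_le : ‖e‖ ≤ 2 := by
  have h1 : ‖e‖ ^ 2 = 3 := by
    have := inner_self_eq_norm_sq (𝕜 := ℂ) e
    rw [h.inner_e] at this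
    simpa using this.symm
  nlinarith [norm_nonneg e]

theorem im_inner_map (v : V) : (⟪v, K v⟫).im = 0 := by
  have h1 : (starRingEnd ℂ) ⟪v, K v⟫ = ⟪v, K v⟫ := by
    rw [inner_conj_symm, h.symm]
  exact Complex.conj_eq_iff_im.1 h1

theorem cubic_zero : N 0 = 0 := by
  have := h.cubic_smul 0 0
  simpa using this

theorem norm_cubic_le (w : V) : ‖N w‖ ≤ C * ‖w‖ ^ 2 * ‖w‖ := by
  have := h.cubic_lip w 0
  simpa [h.cubic_zero] using this

/-- Lax–Milgram: the rank-one term ⟪e, ·⟫e fills in the kernel direction of 1 - 3K, and `coercive`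
is exactly the lower bound on the form of the sum. -/
theorem isUnit_opA [CompleteSpace V] : IsUnit (opA K e) := by
  refine ContinuousLinearMap.isUnit_of_forall_le_norm_inner_map _ (c := ⟨δ, h.delta_pos.le⟩)
    (by exact_mod_cast h.delta_pos) fun x => ?_
  have e1 : (⟪opA K e x, x⟫).re = ‖x‖ ^ 2 - 3 * (⟪x, K x⟫).re + ‖⟪e, x⟫‖ ^ 2 := by
    rw [opA_apply, inner_add_left, inner_sub_left, inner_smul_left, inner_smul_left, h.symm]
    rw [Complex.add_re, Complex.sub_re]
    have h1 : (⟪x, x⟫).re = ‖x‖ ^ 2 := by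
      rw [inner_self_eq_norm_sq_to_K]; norm_cast
    rw [h1, Complex.conj_mul', Complex.conj_ofNat, ← Complex.ofReal_pow, Complex.ofReal_re]
    simp
  calc ‖x‖ ^ 2 * δ ≤ (⟪opA K e x, x⟫).re := by rw [e1]; linarith [h.coercive x]
    _ ≤ _ := Complex.re_le_norm _

/-- The fixed point map of the reduced equation is Lipschitz near `0`. -/
theorem exists_lipschitz_rhs : ∃ r L : ℝ, 0 < r ∧ 0 ≤ L ∧
    (∀ x, ‖x‖ ≤ r → 0 < (⟪e, N (e + x)⟫).re) ∧
    ∀ x y, ‖x‖ ≤ r → ‖y‖ ≤ r → |coeff N e x - coeff N e y| ≤ L * ‖x - y‖ ∧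
      ‖rhs K N e x - rhs K N e y‖ ≤ L * ‖x - y‖ := by
  set n₀ := (⟪e, N e⟫).re with hn₀
  have hn : 0 < n₀ := h.cubic_e_pos
  have hC := h.C_nonneg
  -- With ‖e‖ ≤ 2 and ‖x‖, ‖y‖ ≤ 1 the sum of the two norms in `cubic_lip` is at most 6.
  set L₁ : ℝ := C * 36 with hL₁
  have hL₁0 : 0 ≤ L₁ := by positivity
  have he := h.norm_e_le
  have lipN : ∀ x y, ‖x‖ ≤ 1 → ‖y‖ ≤ 1 → ‖N (e + x) - N (e + y)‖ ≤ L₁ * ‖x - y‖ := by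
    intro x y hx hy
    refine (h.cubic_lip _ _).trans ?_
    rw [add_sub_add_left_eq_sub]
    have h1 := norm_add_le e x
    have h2 := norm_add_le e y
    have h3 : (‖e + x‖ + ‖e + y‖) ^ 2 ≤ 36 := by
      have : ‖e + x‖ + ‖e + y‖ ≤ 6 := by linarith
      nlinarith [norm_nonneg (e + x), norm_nonneg (e + y)]
    have h4 : C * (‖e + x‖ + ‖e + y‖) ^ 2 ≤ L₁ := mul_le_mul_of_nonneg_left h3 hC
    gcongr
  have bddN : ∀ x, ‖x‖ ≤ 1 → ‖N (e + x)‖ ≤ C * 27 := by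
    intro x hx
    refine (h.norm_cubic_le _).trans ?_
    have h1 : ‖e + x‖ ≤ 3 := by linarith [norm_add_le e x]
    have h2 : ‖e + x‖ ^ 2 * ‖e + x‖ ≤ 27 := by
      calc ‖e + x‖ ^ 2 * ‖e + x‖ ≤ 3 ^ 2 * 3 := by gcongr
        _ = 27 := by norm_num
    rw [mul_assoc]
    gcongr
  have lipI : ∀ x y, ‖x‖ ≤ 1 → ‖y‖ ≤ 1 →
      |(⟪e, N (e + x)⟫).re - (⟪e, N (e + y)⟫).re| ≤ 2 * L₁ * ‖x - y‖ := by
    intro x y hx hy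
    rw [← Complex.sub_re, ← inner_sub_right]
    refine (Complex.abs_re_le_norm _).trans ((norm_inner_le_norm _ _).trans ?_)
    rw [mul_assoc]
    exact mul_le_mul he (lipN x y hx hy) (norm_nonneg _) (by norm_num)
  -- On this ball the pairing with e moves by at most n₀/2, so the denominator of `coeff` stays
  -- above n₀/2.
  set r : ℝ := min 1 (n₀ / (4 * L₁ + 4)) with hr
  have hr0 : 0 < r := by positivity
  have hr1 : r ≤ 1 := min_le_left _ _
  have lower : ∀ x, ‖x‖ ≤ r → n₀ / 2 ≤ (⟪e, N (e + x)⟫).re := by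
    intro x hx
    have h1 := lipI x 0 (hx.trans hr1) (by simp)
    simp only [add_zero, sub_zero] at h1
    have h2 : ‖x‖ ≤ n₀ / (4 * L₁ + 4) := hx.trans (min_le_right _ _)
    rw [le_div_iff₀ (by positivity)] at h2
    have h3 := (abs_le.1 h1).1
    nlinarith [norm_nonneg x]
  have lipk : ∀ x y, ‖x‖ ≤ r → ‖y‖ ≤ r →
      |coeff N e x - coeff N e y| ≤ 8 * L₁ / n₀ ^ 2 * ‖x - y‖ := by
    intro x y hx hy
    have hx' := lower x hx
    have hy' := lower y hy
    have h1 := lipI x y (hx.trans hr1) (hy.trans hr1)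
    unfold coeff
    set a := (⟪e, N (e + x)⟫).re
    set b := (⟪e, N (e + y)⟫).re
    have ha : 0 < a := by linarith
    have hb : 0 < b := by linarith
    rw [inv_sub_inv ha.ne' hb.ne', abs_div, abs_of_pos (mul_pos ha hb), abs_sub_comm,
      div_le_iff₀ (by positivity)]
    have h2 : n₀ ^ 2 / 4 ≤ a * b := by nlinarith
    calc |a - b| ≤ 2 * L₁ * ‖x - y‖ := h1
      _ = 8 * L₁ / n₀ ^ 2 * ‖x - y‖ * (n₀ ^ 2 / 4) := by field_simp; ring
      _ ≤ _ := by gcongr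
  have bddk : ∀ x, ‖x‖ ≤ r → |coeff N e x| ≤ 2 / n₀ := by
    intro x hx
    have hx' := lower x hx
    unfold coeff
    rw [abs_inv, abs_of_pos (by linarith), inv_le_comm₀ (by linarith) (by positivity), inv_div]
    exact hx'
  refine ⟨r, 8 * L₁ / n₀ ^ 2 + (‖K‖ + (2 / n₀ * L₁ + 8 * L₁ / n₀ ^ 2 * (C * 27))), hr0,
    by positivity, fun x hx => by linarith [lower x hx], fun x y hx hy => ⟨?_, ?_⟩⟩
  · refine (lipk x y hx hy).trans ?_
    gcongr
    have : 0 ≤ ‖K‖ + (2 / n₀ * L₁ + 8 * L₁ / n₀ ^ 2 * (C * 27)) := by positivity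
    linarith
  · have e1 : rhs K N e x - rhs K N e y = K (x - y) -
        (((coeff N e x : ℝ) : ℂ) • (N (e + x) - N (e + y)) +
          ((coeff N e x - coeff N e y : ℝ) : ℂ) • N (e + y)) := by
      simp only [rhs, map_add, map_sub]
      push_cast
      module
    rw [e1]
    have h1 : ‖K (x - y)‖ ≤ ‖K‖ * ‖x - y‖ := K.le_opNorm _
    have h2 : ‖((coeff N e x : ℝ) : ℂ) • (N (e + x) - N (e + y))‖ ≤ 2 / n₀ * (L₁ * ‖x - y‖) := by
      rw [norm_smul, Complex.norm_real]
      exact mul_le_mul (bddk x hx) (lipN x y (hx.trans hr1) (hy.trans hr1)) (norm_nonneg _)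
        (by positivity)
    have h3 : ‖((coeff N e x - coeff N e y : ℝ) : ℂ) • N (e + y)‖ ≤
        8 * L₁ / n₀ ^ 2 * ‖x - y‖ * (C * 27) := by
      rw [norm_smul, Complex.norm_real]
      exact mul_le_mul (lipk x y hx hy) (bddN y (hy.trans hr1)) (norm_nonneg _) (by positivity)
    have h4 := (norm_sub_le (K (x - y)) _).trans (add_le_add h1 ((norm_add_le _ _).trans
      (add_le_add h2 h3)))
    refine h4.trans ?_
    have h5 : 0 ≤ 8 * L₁ / n₀ ^ 2 * ‖x - y‖ := by positivity
    nlinarith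

omit h in
theorem proj_eq_self {v : V} (hv : ⟪e, v⟫ = 0) : proj e v = v := by
  rw [proj_apply, hv]; simp

/-- `coeff` inverts only the real part, so this quantity has zero real part by construction; its
imaginary part needs a separate argument. -/
theorem inner_e_rhs {ξ : V} (hξ : ⟪e, ξ⟫ = 0) :
    ⟪e, rhs K N e ξ⟫ = 1 - ((coeff N e ξ : ℝ) : ℂ) * ⟪e, N (e + ξ)⟫ := by
  have h1 := h.inner_e_map (e + ξ)
  rw [inner_add_right, hξ, h.inner_e] at h1
  have h2 : ⟪e, K (e + ξ)⟫ = 1 := by linear_combination h1 / 3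
  rw [rhs, inner_sub_right, inner_smul_right, h2]

theorem sub_map_add (ξ : V) : (e + ξ) - (3 : ℂ) • K (e + ξ) = ξ - (3 : ℂ) • K ξ := by
  rw [map_add, smul_add, h.map_e]
  abel

/-- A solution of the reduced equation solves the full rescaled one. -/
theorem sub_map_eq_of_reduced {ξ : V} {η : ℝ} (hη : η ≠ 0) (hξ : ⟪e, ξ⟫ = 0)
    (hpos : 0 < (⟪e, N (e + ξ)⟫).re)
    (heq : ξ - (3 : ℂ) • K ξ = (η : ℂ) • proj e (rhs K N e ξ)) :
    ξ - (3 : ℂ) • K ξ = (η : ℂ) • rhs K N e ξ := by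
  have hη' : (η : ℂ) ≠ 0 := by exact_mod_cast hη
  suffices hz : ⟪e, rhs K N e ξ⟫ = 0 by rw [heq, proj_eq_self hz]
  apply Complex.ext
  · rw [h.inner_e_rhs hξ, Complex.sub_re, Complex.re_ofReal_mul, coeff,
      inv_mul_cancel₀ hpos.ne']
    simp
  · set c := ⟪e, rhs K N e ξ⟫ with hc
    -- Pairing with w = e + ξ makes ⟪w, w⟫, ⟪w, Kw⟫ and ⟪w, N w⟫ all real. The only imaginary
    -- contribution left is η times that of the component removed by `proj`, so it vanishes.
    have e1 := congrArg (fun y => ⟪e + ξ, y⟫) heq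
    have h3 : ⟪e + ξ, e⟫ = 3 := by
      rw [inner_add_left, h.inner_e, ← inner_conj_symm ξ e, hξ]; simp
    rw [← h.sub_map_add, proj_apply, inner_smul_right, inner_sub_right, inner_sub_right,
      inner_smul_right, inner_smul_right, h3, ← hc] at e1
    rw [rhs, inner_sub_right, inner_smul_right] at e1
    have e2 := congrArg Complex.im e1
    have i1 := h.im_inner_map (e + ξ)
    have i2 := h.cubic_self_im (e + ξ)
    have i3 : (⟪e + ξ, e + ξ⟫).im = 0 := inner_self_im (𝕜 := ℂ) _
    rw [Complex.im_ofReal_mul, Complex.sub_im, Complex.sub_im, Complex.sub_im,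
      Complex.im_ofReal_mul, i1, i2, i3] at e2
    have e3 : ((3 : ℂ) * ⟪e + ξ, K (e + ξ)⟫).im = 0 := by
      rw [Complex.mul_im, i1]; simp
    have e4 : ((3 : ℂ)⁻¹ * c * 3).im = c.im := by
      congr 1; ring
    rw [e3, e4] at e2
    have e5 : η * c.im = 0 := by linarith
    simpa [hη] using e5

/-- Any solution with small parameter is a small multiple of `e`, up to a small relative error. -/
theorem exists_smul_add_of_solution {r : ℝ} (hr : 0 < r) : ∃ η₁ : ℝ, 0 < η₁ ∧
    ∀ η ∈ Ioo 0 η₁, ∀ Q : V, Q ≠ 0 → Q - (3 : ℂ) • K Q = (η : ℂ) • K Q - N Q →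
      ∃ (b : ℂ) (ξ : V), b ≠ 0 ∧ Q = b • (e + ξ) ∧ ‖ξ‖ ≤ r ∧ ⟪e, ξ⟫ = 0 := by
  have hC := h.C_nonneg
  have hδ := h.delta_pos
  -- ηD‖Q‖ will bound ηKQ - N(Q): ‖Q‖² ≤ 4m ≤ 4Cη makes the cubic part at most 4C²η‖Q‖.
  set D : ℝ := ‖K‖ + 4 * C ^ 2 with hD
  have hD0 : 0 ≤ D := by positivity
  -- The three bounds serve, in order, 3 + η ≤ 4, then ηD ≤ δ/2 to absorb ‖ζ‖, then 4ηD ≤ δr to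
  -- reach relative size r.
  refine ⟨min 1 (min (δ / (2 * D + 2)) (δ * r / (4 * D + 4))), by positivity, ?_⟩
  rintro η ⟨hη0, hη⟩ Q hQ heq
  have hη1 : η < 1 := hη.trans_le (min_le_left _ _)
  have hη2 : η ≤ δ / (2 * D + 2) := hη.le.trans ((min_le_right _ _).trans (min_le_left _ _))
  have hη3 : η ≤ δ * r / (4 * D + 4) := hη.le.trans ((min_le_right _ _).trans (min_le_right _ _))
  rw [le_div_iff₀ (by positivity)] at hη2 hη3
  set m := (⟪Q, K Q⟫).re with hm
  set n := (⟪Q, N Q⟫).re with hn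
  have hn0 : 0 ≤ n := h.cubic_self_nonneg Q
  have hQpos : 0 < ‖Q‖ := norm_pos_iff.2 hQ
  have energy : ‖Q‖ ^ 2 - 3 * m = η * m - n := by
    have e1 := congrArg (fun y => (⟪Q, y⟫).re) heq
    simp only [inner_sub_right, inner_smul_right, Complex.sub_re, Complex.re_ofReal_mul] at e1
    have h1 : (⟪Q, Q⟫).re = ‖Q‖ ^ 2 := by
      rw [inner_self_eq_norm_sq_to_K]; norm_cast
    have h2 : ((3 : ℂ) * ⟪Q, K Q⟫).re = 3 * m := by simp [hm]
    rw [h1, h2] at e1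
    exact e1
  have hm0 : 0 < m := by nlinarith
  have h4m : ‖Q‖ ^ 2 ≤ 4 * m := by nlinarith
  have hnm : n ≤ η * m := by linarith [h.le_norm_sq Q]
  have hmC : m ≤ C * η := by
    -- m² ≤ Cn together with n ≤ ηm forces m ≤ Cη: this is what makes arbitrary solutions small.
    have h1 := h.apriori Q h4m
    have h2 : m * m ≤ (C * η) * m := by nlinarith
    exact le_of_mul_le_mul_right h2 hm0
  have hNQ : ‖N Q‖ ≤ 4 * C ^ 2 * η * ‖Q‖ := by
    refine (h.norm_cubic_le Q).trans ?_
    have : C * ‖Q‖ ^ 2 ≤ 4 * C ^ 2 * η := by nlinarith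
    gcongr
  set b : ℂ := (3 : ℂ)⁻¹ * ⟪e, Q⟫ with hb
  set ζ := proj e Q with hζ
  have hζe : ⟪e, ζ⟫ = 0 := h.inner_e_proj Q
  have hQd : Q = b • e + ζ := by rw [hζ, proj_apply]; abel
  have hζeq : ζ - (3 : ℂ) • K ζ = (η : ℂ) • K Q - N Q := by
    rw [← heq]
    conv_rhs => rw [hQd]
    rw [map_add, map_smul, smul_add, smul_comm (3 : ℂ) b, h.map_e]
    abel
  have hy : ‖(η : ℂ) • K Q - N Q‖ ≤ η * D * ‖Q‖ := by
    refine (norm_sub_le _ _).trans ?_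
    rw [norm_smul, Complex.norm_real, Real.norm_of_nonneg hη0.le]
    have := mul_le_mul_of_nonneg_left (K.le_opNorm Q) hη0.le
    rw [hD]
    nlinarith
  have hζn : δ * ‖ζ‖ ≤ η * D * ‖Q‖ := by
    have h1 := h.coercive ζ
    rw [hζe] at h1
    have h2 : (⟪ζ, ζ - (3 : ℂ) • K ζ⟫).re = ‖ζ‖ ^ 2 - 3 * (⟪ζ, K ζ⟫).re := by
      have h1 : (⟪ζ, ζ⟫).re = ‖ζ‖ ^ 2 := by
        rw [inner_self_eq_norm_sq_to_K]; norm_cast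
      rw [inner_sub_right, inner_smul_right, Complex.sub_re, h1]
      simp
    have h3 : (⟪ζ, ζ - (3 : ℂ) • K ζ⟫).re ≤ ‖ζ‖ * (η * D * ‖Q‖) := by
      refine (Complex.re_le_norm _).trans ((norm_inner_le_norm _ _).trans ?_)
      rw [hζeq]
      gcongr
    rcases (norm_nonneg ζ).eq_or_lt with h0 | h0
    · rw [← h0, mul_zero]; positivity
    · have : ‖ζ‖ * (δ * ‖ζ‖) ≤ ‖ζ‖ * (η * D * ‖Q‖) := by
        simp only [norm_zero] at h1
        nlinarith
      exact le_of_mul_le_mul_left this h0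
  have hQle : ‖Q‖ ≤ 2 * ‖b‖ + ‖ζ‖ := by
    conv_lhs => rw [hQd]
    refine (norm_add_le _ _).trans ?_
    rw [norm_smul]
    nlinarith [h.norm_e_le, norm_nonneg b]
  have hζr : ‖ζ‖ ≤ r * ‖b‖ := by
    have h1 : η * D ≤ δ / 2 := by nlinarith
    have h2 : 4 * (η * D) ≤ δ * r := by nlinarith
    have h3 : δ * ‖ζ‖ ≤ η * D * (2 * ‖b‖ + ‖ζ‖) := hζn.trans (by gcongr)
    have h4 : δ / 2 * ‖ζ‖ ≤ 2 * (η * D) * ‖b‖ := by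
      nlinarith [mul_le_mul_of_nonneg_right h1 (norm_nonneg ζ)]
    have h5 : δ / 2 * ‖ζ‖ ≤ δ / 2 * (r * ‖b‖) := by
      nlinarith [mul_le_mul_of_nonneg_right h2 (norm_nonneg b)]
    exact le_of_mul_le_mul_left h5 (by positivity)
  have hb0 : b ≠ 0 := by
    intro hb0
    rw [hb0] at hζr hQle
    simp only [norm_zero, mul_zero, zero_add] at hζr hQle
    linarith
  refine ⟨b, b⁻¹ • ζ, hb0, ?_, ?_, ?_⟩
  · rw [smul_add, smul_inv_smul₀ hb0]; exact hQd
  · rw [norm_smul, norm_inv, inv_mul_le_iff₀ (norm_pos_iff.2 hb0), mul_comm]; exact hζr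
  · rw [inner_smul_right, hζe, mul_zero]

/-- Bifurcation of a branch of solutions, unique up to a phase. -/
theorem exists_branch [CompleteSpace V] : ∃ η₀ : ℝ, 0 < η₀ ∧ ∃ (α : ℝ → ℝ) (ξ : ℝ → V),
    ξ 0 = 0 ∧ ContinuousOn α (Ico 0 η₀) ∧ ContinuousOn ξ (Ico 0 η₀) ∧
    (∀ η ∈ Ico 0 η₀, 0 < α η ∧ ⟪e, ξ η⟫ = 0) ∧
    ∀ η ∈ Ioo 0 η₀,
      (∀ Q : V, Q = ((√η * α η : ℝ) : ℂ) • (e + ξ η) →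
        Q ≠ 0 ∧ Q - (3 : ℂ) • K Q = (η : ℂ) • K Q - N Q) ∧
      ∀ Q : V, Q ≠ 0 → Q - (3 : ℂ) • K Q = (η : ℂ) • K Q - N Q →
        ∃ c : ℂ, ‖c‖ = 1 ∧ Q = c • ((√η * α η : ℝ) : ℂ) • (e + ξ η) := by
  obtain ⟨r, L, hr, hL, hpos, hlip⟩ := h.exists_lipschitz_rhs
  obtain ⟨⟨A, B, hAB, hBA⟩, hA⟩ := h.isUnit_opA
  have hA : A = opA K e := hA
  have hABx : ∀ x, opA K e (B x) = x := fun x => by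
    rw [← hA]; exact congrArg (fun T : V →L[ℂ] V => T x) hAB
  have hBAx : ∀ x, B (opA K e x) = x := fun x => by
    rw [← hA]; exact congrArg (fun T : V →L[ℂ] V => T x) hBA
  -- Working with `opA` on the whole space avoids restricting to the complement of e: fixed points
  -- turn out to be orthogonal to e, since ⟪e, A x⟫ = 3⟪e, x⟫.
  set T : V →L[ℂ] V := B.comp (proj e) with hT
  let G : V → V := fun x => T (rhs K N e x)
  have hG : ∀ x y, ‖x‖ ≤ r → ‖y‖ ≤ r → ‖G x - G y‖ ≤ (‖T‖ * L) * ‖x - y‖ := by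
    intro x y hx hy
    simp only [G]
    rw [← map_sub, mul_assoc]
    exact (T.le_opNorm _).trans (mul_le_mul_of_nonneg_left (hlip x y hx hy).2 (norm_nonneg _))
  obtain ⟨η₀, hη₀, ξ, hξ0, hξ, hξc⟩ := exists_fixedPoint_smul G hr (by positivity) hG
  obtain ⟨η₁, hη₁, hsol⟩ := h.exists_smul_add_of_solution hr
  have hsub : Ico 0 (min η₀ η₁) ⊆ Ico 0 η₀ := Ico_subset_Ico_right (min_le_left _ _)
  have fix_iff : ∀ (η : ℝ) x, x = η • G x → opA K e x = (η : ℂ) • proj e (rhs K N e x) := by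
    intro η x hx
    conv_lhs => rw [hx]
    rw [← Complex.coe_smul, map_smul]
    simp only [G, hT, ContinuousLinearMap.comp_apply]
    rw [hABx]
  have orth : ∀ η ∈ Ico 0 η₀, ⟪e, ξ η⟫ = 0 := by
    intro η hη
    have h1 := congrArg (fun y => ⟪e, y⟫) (fix_iff η _ (hξ η hη).2.1)
    simp only [h.inner_e_opA, inner_smul_right, h.inner_e_proj, mul_zero] at h1
    simpa using h1
  have cpos : ∀ x, ‖x‖ ≤ r → 0 < coeff N e x := fun x hx => inv_pos.2 (hpos x hx)
  have redeq : ∀ η ∈ Ico 0 η₀, ξ η - (3 : ℂ) • K (ξ η) =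
      (η : ℂ) • proj e (rhs K N e (ξ η)) := by
    intro η hη
    have h1 := fix_iff η _ (hξ η hη).2.1
    rw [opA_apply, orth η hη, zero_smul, add_zero] at h1
    exact h1
  refine ⟨min η₀ η₁, by positivity, fun η => √(coeff N e (ξ η)), ξ, hξ0, ?_, hξc.mono hsub,
    fun η hη => ⟨Real.sqrt_pos.2 (cpos _ (hξ η (hsub hη)).1), orth η (hsub hη)⟩, ?_⟩
  · refine ContinuousOn.sqrt ?_
    have l1 : LipschitzOnWith L.toNNReal (coeff N e) (Metric.closedBall 0 r) := by
      refine LipschitzOnWith.of_dist_le_mul fun x hx y hy => ?_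
      rw [Real.coe_toNNReal _ hL, dist_eq_norm, dist_eq_norm]
      exact (hlip x y (mem_closedBall_zero_iff.1 hx) (mem_closedBall_zero_iff.1 hy)).1
    exact l1.continuousOn.comp (hξc.mono hsub)
      fun η hη => mem_closedBall_zero_iff.2 (hξ η (hsub hη)).1
  rintro η ⟨hη0, hη⟩
  have hηI : η ∈ Ico 0 η₀ := ⟨hη0.le, hη.trans_le (min_le_left _ _)⟩
  set κ := coeff N e (ξ η) with hκ
  have hκ0 : 0 < κ := cpos _ (hξ η hηI).1
  constructor
  · rintro Q rfl
    have hs : (0 : ℝ) < √η * √κ := by positivity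
    have hs' : ((√η * √κ : ℝ) : ℂ) ≠ 0 := by exact_mod_cast hs.ne'
    have hw : e + ξ η ≠ 0 := by
      intro h0
      have h1 := inner_add_right (𝕜 := ℂ) e e (ξ η)
      rw [h0, h.inner_e, orth η hηI, inner_zero_right] at h1
      norm_num at h1
    refine ⟨smul_ne_zero hs' hw, ?_⟩
    have e1 := h.sub_map_eq_of_reduced hη0.ne' (orth η hηI) (hpos _ (hξ η hηI).1) (redeq η hηI)
    rw [← h.sub_map_add, rhs, ← hκ] at e1
    rw [h.cubic_smul, map_smul, smul_comm (3 : ℂ), ← smul_sub, e1, Complex.norm_real,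
      Real.norm_of_nonneg hs.le, mul_pow, Real.sq_sqrt hη0.le, Real.sq_sqrt hκ0.le]
    push_cast
    module
  · intro Q hQ heq
    obtain ⟨b, x, hb, rfl, hx, hxe⟩ := hsol η ⟨hη0, hη.trans_le (min_le_right _ _)⟩ Q hQ heq
    have e1 : x - (3 : ℂ) • K x = (η : ℂ) • K (e + x) - ((‖b‖ ^ 2 : ℝ) : ℂ) • N (e + x) := by
      rw [h.cubic_smul, map_smul, smul_comm (3 : ℂ) b, ← smul_sub, h.sub_map_add,
        smul_comm _ b, smul_comm _ b, ← smul_sub] at heq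
      exact smul_right_injective V hb heq
    -- The bifurcation equation. It fixes |b|, and leaves the phase of b as the only freedom.
    have e2 : (η : ℂ) = ((‖b‖ ^ 2 : ℝ) : ℂ) * ⟪e, N (e + x)⟫ := by
      have h1 := congrArg (fun y => ⟪e, y⟫) e1
      simp only [h.inner_e_sub] at h1
      rw [inner_sub_right, inner_smul_right, inner_smul_right] at h1
      have h2 := h.inner_e_map (e + x)
      rw [inner_add_right, hxe, h.inner_e] at h2
      linear_combination -h1 - (η : ℂ) / 3 * h2
    have e3 : η = ‖b‖ ^ 2 * (⟪e, N (e + x)⟫).re := by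
      have := congrArg Complex.re e2
      rwa [Complex.ofReal_re, Complex.re_ofReal_mul] at this
    have hp := hpos x hx
    have e4 : ‖b‖ ^ 2 = η * coeff N e x := by
      rw [coeff]; field_simp; linarith
    have e5 : x - (3 : ℂ) • K x = (η : ℂ) • rhs K N e x := by
      rw [e1, e4, rhs]; push_cast; module
    have e6 : ⟪e, rhs K N e x⟫ = 0 := by
      have h1 := congrArg (fun y => ⟪e, y⟫) e5
      simp only [h.inner_e_sub, inner_smul_right] at h1
      have : (η : ℂ) ≠ 0 := by exact_mod_cast hη0.ne'
      simpa [this] using h1.symm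
    have e7 : x = η • G x := by
      have h1 : opA K e x = (η : ℂ) • proj e (rhs K N e x) := by
        rw [opA_apply, hxe, zero_smul, add_zero, proj_eq_self e6, e5]
      have h2 := congrArg B h1
      rw [hBAx, map_smul, Complex.coe_smul] at h2
      exact h2
    have e8 : x = ξ η := (hξ η hηI).2.2 x hx e7
    have hb' : ‖b‖ = √η * √κ := by
      rw [← Real.sqrt_mul hη0.le, hκ, ← e8, ← e4, Real.sqrt_sq (norm_nonneg _)]
    have hbn : (‖b‖ : ℂ) ≠ 0 := by exact_mod_cast (norm_pos_iff.2 hb).ne'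
    refine ⟨b / ‖b‖, by simp [norm_pos_iff.2 hb |>.ne'], ?_⟩
    have hb2 : ((√η * √(coeff N e (ξ η)) : ℝ) : ℂ) = (‖b‖ : ℂ) := by rw [hb', hκ]
    rw [smul_smul, hb2, div_mul_cancel₀ _ hbn, e8]

end CubicBifurcation

/-! ### Weak derivatives and density of Schwartz functions in H¹. -/

/-- The standard basis vectors of the plane. -/
abbrev unitVec (i : Fin 2) : Plane := EuclideanSpace.single i 1

theorem hasWeakDeriv_iff {i : Fin 2} {u g : L2} : HasWeakDeriv i u g ↔
    ∀ φ : 𝓢(Plane, ℂ), ∫ x, φ x * g x = - ∫ x, (∂_{unitVec i} φ) x * u x := by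
  unfold HasWeakDeriv
  rw [DFunLike.ext_iff]
  refine forall_congr' fun φ => ?_
  rw [TemperedDistribution.lineDerivOp_apply_apply, Lp.toTemperedDistribution_apply,
    Lp.toTemperedDistribution_apply, eq_comm]
  simp [integral_neg]

theorem hasWeakDeriv_toLp (i : Fin 2) (ψ : 𝓢(Plane, ℂ)) :
    HasWeakDeriv i (ψ.toLp 2) ((∂_{unitVec i} ψ).toLp 2) := by
  unfold HasWeakDeriv
  rw [Lp.toTemperedDistribution_toLp_eq, Lp.toTemperedDistribution_toLp_eq,
    TemperedDistribution.lineDerivOp_toTemperedDistributionCLM_eq]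

/-- Two square integrable functions with equal integrals against Schwartz functions agree. -/
theorem eq_zero_of_integral_schwartz_eq_zero {u : L2}
    (h : ∀ φ : 𝓢(Plane, ℂ), ∫ x, φ x * u x = 0) : u = 0 := by
  have inj := LinearMap.ker_eq_bot.1
    (Lp.ker_toTemperedDistributionCLM_eq_bot (E := Plane) (F := ℂ) (μ := volume) (p := 2))
  apply inj
  ext φ
  simpa using h φ

open Laplacian in
/-- The operator `1 - Δ` is onto on Schwartz functions. -/
theorem exists_sub_laplacian_eq (θ : 𝓢(Plane, ℂ)) :
    ∃ φ : 𝓢(Plane, ℂ), φ - ∑ i, ∂_{unitVec i} (∂_{unitVec i} φ) = θ := by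
  -- The Fourier symbol of 1 - Δ; `g₂` is its reciprocal, also of temperate growth.
  let g₁ : Plane → ℝ := fun x => 1 + (2 * Real.pi) ^ 2 * ‖x‖ ^ 2
  let g₂ : Plane → ℝ := fun x => (1 + ‖(2 * Real.pi) • x‖ ^ 2) ^ (-1 : ℝ)
  have hg₁ : g₁.HasTemperateGrowth := by fun_prop
  have hg₂ : g₂.HasTemperateGrowth := by
    have h := Function.hasTemperateGrowth_one_add_norm_sq_rpow Plane (-1)
    have h2 : Function.HasTemperateGrowth (fun x : Plane => (2 * Real.pi) • x) := by fun_prop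
    exact h.comp h2
  refine ⟨SchwartzMap.fourierMultiplierCLM ℂ g₂ θ, ?_⟩
  have h1 : ∀ φ : 𝓢(Plane, ℂ), φ - ∑ i, ∂_{unitVec i} (∂_{unitVec i} φ) =
      SchwartzMap.fourierMultiplierCLM ℂ g₁ φ := by
    intro φ
    have h2 := SchwartzMap.laplacian_eq_sum (EuclideanSpace.basisFun (Fin 2) ℝ) φ
    simp only [EuclideanSpace.basisFun_apply] at h2
    rw [← h2, SchwartzMap.laplacian_eq_fourierMultiplierCLM]
    have e1 : g₁ = fun x => ∑ j ∈ (Finset.univ : Finset (Fin 2)),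
        (![fun _ => 1, (2 * Real.pi) ^ 2 • (‖·‖ ^ 2)] : Fin 2 → Plane → ℝ) j x := by
      funext x
      simp [g₁]
    rw [e1, SchwartzMap.fourierMultiplierCLM_sum]
    · simp only [Fin.sum_univ_two, Matrix.cons_val_zero, Matrix.cons_val_one]
      rw [SchwartzMap.fourierMultiplierCLM_smul (by
        exact Function.hasTemperateGrowth_norm_sq _)]
      simp
    · intro j _
      fin_cases j
      · exact Function.HasTemperateGrowth.const (1 : ℝ)
      · have : Function.HasTemperateGrowth (fun x : Plane => (2 * Real.pi) ^ 2 * ‖x‖ ^ 2) := by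
          fun_prop
        exact this
  rw [h1, SchwartzMap.fourierMultiplierCLM_fourierMultiplierCLM_apply hg₁ hg₂]
  have e2 : g₁ * g₂ = fun _ => 1 := by
    funext x
    simp only [g₁, g₂, Pi.mul_apply, norm_smul, mul_pow, Real.norm_eq_abs, sq_abs, Real.rpow_neg_one]
    exact mul_inv_cancel₀ (by positivity)
  rw [e2]
  simp

/-- The complex conjugate of a Schwartz function. -/
def conjSchwartz (φ : 𝓢(Plane, ℂ)) : 𝓢(Plane, ℂ) :=
  φ.postcompCLM (𝕜 := ℝ) (Complex.conjCLE : ℂ →L[ℝ] ℂ)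

theorem conjSchwartz_apply (φ : 𝓢(Plane, ℂ)) (x : Plane) :
    conjSchwartz φ x = (starRingEnd ℂ) (φ x) := rfl

theorem lineDeriv_conjSchwartz (φ : 𝓢(Plane, ℂ)) (m : Plane) :
    ∂_{m} (conjSchwartz φ) = conjSchwartz (∂_{m} φ) := by
  ext x
  rw [conjSchwartz_apply, SchwartzMap.lineDerivOp_apply_eq_fderiv,
    SchwartzMap.lineDerivOp_apply_eq_fderiv]
  have h := (Complex.conjCLE.toContinuousLinearMap.hasFDerivAt (x := φ x)).comp x
    (φ.hasFDerivAt x)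
  have e : (conjSchwartz φ : Plane → ℂ) = (Complex.conjCLE.toContinuousLinearMap ∘ φ) := rfl
  rw [e, h.fderiv]
  rfl

theorem inner_toLp_left (φ : 𝓢(Plane, ℂ)) (u : L2) :
    inner ℂ (φ.toLp 2) u = ∫ x, conjSchwartz φ x * u x := by
  rw [L2.inner_def]
  refine integral_congr_ae ?_
  filter_upwards [φ.coeFn_toLp 2 volume] with x hx
  rw [hx, conjSchwartz_apply, RCLike.inner_apply, mul_comm]

/-- The graph of the weak gradient. -/
def gradGraph : Submodule ℂ (PiLp 2 (fun _ : Option (Fin 2) => L2)) where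
  carrier := {U | ∀ i, HasWeakDeriv i (U none) (U (some i))}
  add_mem' {U V} hU hV i := by
    have h1 := hU i
    have h2 := hV i
    simp only [HasWeakDeriv, ← Lp.toTemperedDistributionCLM_apply] at h1 h2 ⊢
    simp only [PiLp.add_apply, map_add, LineDeriv.lineDerivOp_add, h1, h2]
  zero_mem' i := by
    simp only [HasWeakDeriv, ← Lp.toTemperedDistributionCLM_apply]
    simp only [PiLp.zero_apply, map_zero]
    ext φ
    simp
  smul_mem' c U hU i := by
    have h1 := hU i
    simp only [HasWeakDeriv, ← Lp.toTemperedDistributionCLM_apply] at h1 ⊢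
    simp only [PiLp.smul_apply, map_smul, LineDeriv.lineDerivOp_smul, h1]

theorem isClosed_hasWeakDeriv (i : Fin 2) : IsClosed {p : L2 × L2 | HasWeakDeriv i p.1 p.2} := by
  let T := Lp.toTemperedDistributionCLM (E := Plane) ℂ volume 2
  have h1 : Continuous fun p : L2 × L2 => LineDeriv.lineDerivOpCLM ℂ 𝓢'(Plane, ℂ) (unitVec i) (T p.1) :=
    (ContinuousLinearMap.continuous _).comp (T.continuous.comp continuous_fst)
  have h2 : Continuous fun p : L2 × L2 => T p.2 := T.continuous.comp continuous_snd
  exact isClosed_eq h1 h2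

theorem isClosed_gradGraph :
    IsClosed (gradGraph : Set (PiLp 2 (fun _ : Option (Fin 2) => L2))) := by
  have : (gradGraph : Set (PiLp 2 (fun _ : Option (Fin 2) => L2))) =
      ⋂ i, (fun U : PiLp 2 (fun _ : Option (Fin 2) => L2) => (U none, U (some i))) ⁻¹'
        {p : L2 × L2 | HasWeakDeriv i p.1 p.2} := by
    ext U
    simp [gradGraph]
  rw [this]
  refine isClosed_iInter fun i => (isClosed_hasWeakDeriv i).preimage ?_
  fun_prop

/-- The components of the graph of the gradient at a Schwartz function. -/
def gradComp (ψ : 𝓢(Plane, ℂ)) : Option (Fin 2) → L2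
  | none => ψ.toLp 2
  | some i => (∂_{unitVec i} ψ).toLp 2

/-- A Schwartz function together with its gradient. -/
def schwartzGrad : 𝓢(Plane, ℂ) →ₗ[ℂ] PiLp 2 (fun _ : Option (Fin 2) => L2) where
  toFun ψ := WithLp.toLp 2 (gradComp ψ)
  map_add' ψ φ := by
    ext1 j
    rcases j with _ | i
    · exact (SchwartzMap.toLpCLM ℂ ℂ 2 volume).map_add ψ φ
    · simp only [PiLp.add_apply, gradComp, LineDeriv.lineDerivOp_add]
      exact (SchwartzMap.toLpCLM ℂ ℂ 2 volume).map_add _ _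
  map_smul' c ψ := by
    ext1 j
    rcases j with _ | i
    · exact (SchwartzMap.toLpCLM ℂ ℂ 2 volume).map_smul c ψ
    · simp only [PiLp.smul_apply, gradComp, LineDeriv.lineDerivOp_smul]
      exact (SchwartzMap.toLpCLM ℂ ℂ 2 volume).map_smul _ _

/-- Schwartz functions are dense in `H¹`. -/
theorem gradGraph_le_closure : gradGraph ≤ (LinearMap.range schwartzGrad).topologicalClosure := by
  intro U hU
  set S := (LinearMap.range schwartzGrad).topologicalClosure with hS
  have hSc : IsClosed (S : Set (PiLp 2 (fun _ : Option (Fin 2) => L2))) :=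
    Submodule.isClosed_topologicalClosure _
  have : CompleteSpace S := hSc.completeSpace_coe
  have hSg : S ≤ gradGraph := by
    refine Submodule.topologicalClosure_minimal _ ?_ isClosed_gradGraph
    rintro _ ⟨ψ, rfl⟩ i
    exact hasWeakDeriv_toLp i ψ
  obtain ⟨P, hP, W, hW, rfl⟩ := S.exists_add_mem_mem_orthogonal U
  have hWg : W ∈ gradGraph := by
    have := gradGraph.sub_mem hU (hSg hP)
    simpa using this
  -- W lies in the graph and is orthogonal to all Schwartz graphs. Moving derivatives onto the test
  -- function says that its function component annihilates every φ - Δφ, hence every Schwartz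
  -- function. Conjugation offsets the antilinear first slot of the inner product.
  have key : ∀ φ : 𝓢(Plane, ℂ), ∫ x, φ x * (W none) x = 0 := by
    intro θ
    obtain ⟨φ, rfl⟩ := exists_sub_laplacian_eq θ
    have h1 : inner ℂ (schwartzGrad (conjSchwartz φ)) W = 0 :=
      hW _ (Submodule.le_topologicalClosure _ ⟨_, rfl⟩)
    rw [PiLp.inner_apply, Fintype.sum_option] at h1
    simp only [schwartzGrad, LinearMap.coe_mk, AddHom.coe_mk, gradComp] at h1
    have cc : ∀ φ, conjSchwartz (conjSchwartz φ) = φ := fun φ => by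
      ext x; simp [conjSchwartz_apply]
    simp only [inner_toLp_left, lineDeriv_conjSchwartz, cc] at h1
    have hT : ∀ φ : 𝓢(Plane, ℂ), ∫ x, φ x * (W none) x = (W none : 𝓢'(Plane, ℂ)) φ := by
      intro φ; rw [Lp.toTemperedDistribution_apply]; rfl
    have h2 : ∀ i, ∫ x, (∂_{unitVec i} φ) x * (W (some i)) x =
        - (W none : 𝓢'(Plane, ℂ)) (∂_{unitVec i} (∂_{unitVec i} φ)) := fun i => by
      rw [hasWeakDeriv_iff.1 (hWg i), hT]
    simp only [h2] at h1
    rw [hT, map_sub, map_sum, ← hT φ, ← h1, Finset.sum_neg_distrib]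
    ring
  have hW0 : W none = 0 := eq_zero_of_integral_schwartz_eq_zero key
  have hWi : ∀ i, W (some i) = 0 := by
    intro i
    refine eq_zero_of_integral_schwartz_eq_zero fun φ => ?_
    rw [hasWeakDeriv_iff.1 (hWg i), hW0]
    have : ∀ᵐ x : Plane, (∂_{unitVec i} φ) x * (0 : L2) x = 0 := by
      filter_upwards [Lp.coeFn_zero ℂ 2 (volume : Measure Plane)] with x hx
      rw [hx]; simp
    rw [integral_congr_ae this]; simp
  have : W = 0 := by
    ext1 j
    rcases j with _ | i
    · exact hW0
    · exact hWi i
  rw [this, add_zero]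
  exact hP

/-! ### Multiplication operators on L² and the Leibniz rule. -/

theorem norm_sq_eq_integral (u : L2) : ‖u‖ ^ 2 = ∫ x, ‖u x‖ ^ 2 := by
  have h := inner_self_eq_norm_sq (𝕜 := ℂ) u
  rw [← h, L2.inner_def, ← integral_re]
  · refine integral_congr_ae (Eventually.of_forall fun x => ?_)
    exact inner_self_eq_norm_sq (𝕜 := ℂ) (u x)
  · exact L2.integrable_inner u u

theorem memLp_mul_of_bounded (g : Plane → ℂ) (hg : Continuous g) (C : ℝ) (hC : ∀ x, ‖g x‖ ≤ C)
    (u : L2) : MemLp (fun x => g x * u x) 2 (volume : Measure Plane) :=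
  (Lp.memLp u).of_le_mul (hg.aestronglyMeasurable.mul (Lp.aestronglyMeasurable u))
    (Eventually.of_forall fun x => by
      rw [norm_mul]; exact mul_le_mul_of_nonneg_right (hC x) (norm_nonneg _))

/-- Multiplication by a bounded continuous function on `L²`. -/
def mulCLM (g : Plane → ℂ) (hg : Continuous g) (C : ℝ) (hC : ∀ x, ‖g x‖ ≤ C) : L2 →L[ℂ] L2 :=
  have hm := memLp_mul_of_bounded g hg C hC
  LinearMap.mkContinuous
    { toFun := fun u => (hm u).toLp
      map_add' := fun u v => by
        ext1
        filter_upwards [(hm (u + v)).coeFn_toLp, Lp.coeFn_add u v,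
          Lp.coeFn_add ((hm u).toLp) ((hm v).toLp), (hm u).coeFn_toLp, (hm v).coeFn_toLp]
          with x h1 h2 h3 h4 h5
        rw [h1, h2, h3, Pi.add_apply, Pi.add_apply, h4, h5, mul_add]
      map_smul' := fun c u => by
        ext1
        filter_upwards [(hm (c • u)).coeFn_toLp, Lp.coeFn_smul c u,
          Lp.coeFn_smul c ((hm u).toLp), (hm u).coeFn_toLp] with x h1 h2 h3 h4
        simp only [RingHom.id_apply]
        rw [h1, h2, h3, Pi.smul_apply, Pi.smul_apply, h4, smul_eq_mul, smul_eq_mul]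
        ring }
    C (fun u => by
      refine Lp.norm_le_mul_norm_of_ae_le_mul ?_
      filter_upwards [(hm u).coeFn_toLp] with x hx
      simp only [LinearMap.coe_mk, AddHom.coe_mk]
      rw [hx, norm_mul]; exact mul_le_mul_of_nonneg_right (hC x) (norm_nonneg _))

theorem coeFn_mulCLM (g : Plane → ℂ) (hg : Continuous g) (C : ℝ) (hC : ∀ x, ‖g x‖ ≤ C) (u : L2) :
    mulCLM g hg C hC u =ᵐ[volume] fun x => g x * u x :=
  MemLp.coeFn_toLp (memLp_mul_of_bounded g hg C hC u)

/-- Multiplication by a Schwartz function on `L²`. -/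
def mulS (X : 𝓢(Plane, ℂ)) : L2 →L[ℂ] L2 :=
  mulCLM X X.continuous _ (X.norm_le_seminorm ℂ)

theorem coeFn_mulS (X : 𝓢(Plane, ℂ)) (u : L2) : mulS X u =ᵐ[volume] fun x => X x * u x :=
  coeFn_mulCLM _ _ _ _ _

/-- The product of two Schwartz functions. -/
def prodS (X φ : 𝓢(Plane, ℂ)) : 𝓢(Plane, ℂ) := SchwartzMap.smulLeftCLM ℂ X φ

theorem prodS_apply (X φ : 𝓢(Plane, ℂ)) (x : Plane) : prodS X φ x = X x * φ x :=
  SchwartzMap.smulLeftCLM_apply_apply X.hasTemperateGrowth _ _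

theorem lineDeriv_prodS (X φ : 𝓢(Plane, ℂ)) (m : Plane) :
    ∂_{m} (prodS X φ) = prodS X (∂_{m} φ) + prodS (∂_{m} X) φ := by
  ext x
  have e : (prodS X φ : Plane → ℂ) = ⇑X * ⇑φ := funext (prodS_apply X φ)
  rw [add_apply, prodS_apply, prodS_apply, SchwartzMap.lineDerivOp_apply_eq_fderiv,
    SchwartzMap.lineDerivOp_apply_eq_fderiv, SchwartzMap.lineDerivOp_apply_eq_fderiv, e,
    ((X.hasFDerivAt x).mul (φ.hasFDerivAt x)).fderiv]
  simp
  ring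

theorem mulS_toLp (X φ : 𝓢(Plane, ℂ)) : mulS X (φ.toLp 2) = (prodS X φ).toLp 2 := by
  ext1
  filter_upwards [coeFn_mulS X (φ.toLp 2), φ.coeFn_toLp 2 volume,
    (prodS X φ).coeFn_toLp 2 volume] with x h1 h2 h3
  rw [h1, h2, h3, prodS_apply]

theorem toTemperedDistribution_mulS (X φ : 𝓢(Plane, ℂ)) (u : L2) :
    (mulS X u : 𝓢'(Plane, ℂ)) φ = (u : 𝓢'(Plane, ℂ)) (prodS X φ) := by
  rw [Lp.toTemperedDistribution_apply, Lp.toTemperedDistribution_apply]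
  refine integral_congr_ae ?_
  filter_upwards [coeFn_mulS X u] with x h1
  rw [h1, prodS_apply, smul_eq_mul, smul_eq_mul]
  ring

/-- Leibniz rule for weak derivatives. -/
theorem HasWeakDeriv.mulS {i : Fin 2} {u g : L2} (h : HasWeakDeriv i u g) (X : 𝓢(Plane, ℂ)) :
    HasWeakDeriv i (mulS X u) (mulS X g + _root_.mulS (∂_{unitVec i} X) u) := by
  unfold HasWeakDeriv
  ext φ
  rw [TemperedDistribution.lineDerivOp_apply_apply, toTemperedDistribution_mulS,
    ← Lp.toTemperedDistributionCLM_apply (_ + _), map_add, Lp.toTemperedDistributionCLM_apply,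
    Lp.toTemperedDistributionCLM_apply, add_apply, toTemperedDistribution_mulS,
    toTemperedDistribution_mulS]
  have h1 := congrArg (fun T : 𝓢'(Plane, ℂ) => T (prodS X φ)) h
  simp only [TemperedDistribution.lineDerivOp_apply_apply] at h1
  rw [← h1, ← map_add]
  congr 1
  have h2 : prodS X (-∂_{unitVec i} φ) = - prodS X (∂_{unitVec i} φ) :=
    (SchwartzMap.smulLeftCLM ℂ X).map_neg _
  rw [lineDeriv_prodS]
  erw [h2]
  abel

/-! ### The energy space as a Hilbert space, and density of test functions. -/

/-- The ambient space of the energy space: `(|x| u, u, ∂₀ u, ∂₁ u)`. -/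
abbrev Amb : Type := PiLp 2 (fun _ : Option (Option (Fin 2)) => L2)

/-- Multiplication by |x| is unbounded; dividing both sides by 1 + |x| expresses the relation
through two bounded operators. -/
theorem isClosed_mul_norm :
    IsClosed {p : L2 × L2 | p.2 =ᵐ[volume] fun x => (‖x‖ : ℂ) * p.1 x} := by
  have c1 : Continuous fun x : Plane => (((1 + ‖x‖)⁻¹ : ℝ) : ℂ) := by
    refine Complex.continuous_ofReal.comp (Continuous.inv₀ (by fun_prop) fun x => ?_)
    positivity
  have c2 : Continuous fun x : Plane => (((1 + ‖x‖)⁻¹ * ‖x‖ : ℝ) : ℂ) := by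
    refine Complex.continuous_ofReal.comp
      ((Continuous.inv₀ (by fun_prop) fun x => ?_).mul continuous_norm)
    positivity
  have b1 : ∀ x : Plane, ‖(((1 + ‖x‖)⁻¹ : ℝ) : ℂ)‖ ≤ 1 := fun x => by
    rw [Complex.norm_real, Real.norm_of_nonneg (by positivity)]
    exact inv_le_one_of_one_le₀ (by linarith [norm_nonneg x])
  have b2 : ∀ x : Plane, ‖(((1 + ‖x‖)⁻¹ * ‖x‖ : ℝ) : ℂ)‖ ≤ 1 := fun x => by
    rw [Complex.norm_real, Real.norm_of_nonneg (by positivity), inv_mul_le_iff₀ (by positivity)]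
    linarith
  have : {p : L2 × L2 | p.2 =ᵐ[volume] fun x => (‖x‖ : ℂ) * p.1 x} =
      {p : L2 × L2 | mulCLM _ c1 1 b1 p.2 = mulCLM _ c2 1 b2 p.1} := by
    ext ⟨u, h⟩
    simp only [mem_ofPred_eq]
    have key : ∀ x : Plane, ((((1 + ‖x‖)⁻¹ : ℝ) : ℂ) * h x = (((1 + ‖x‖)⁻¹ * ‖x‖ : ℝ) : ℂ) * u x ↔
        h x = (‖x‖ : ℂ) * u x) := fun x => by
      have : (((1 + ‖x‖)⁻¹ : ℝ) : ℂ) ≠ 0 := by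
        have : (1 + ‖x‖)⁻¹ ≠ 0 := by positivity
        exact_mod_cast this
      rw [Complex.ofReal_mul, mul_assoc, mul_right_inj' this]
    constructor
    · intro hh
      ext1
      filter_upwards [hh, coeFn_mulCLM _ c1 1 b1 h, coeFn_mulCLM _ c2 1 b2 u] with x h1 h2 h3
      rw [h2, h3]
      exact (key x).2 h1
    · intro hh
      have h4 := coeFn_mulCLM _ c1 1 b1 h
      rw [hh] at h4
      filter_upwards [h4, coeFn_mulCLM _ c2 1 b2 u] with x h2 h3
      rw [h2] at h3
      exact (key x).1 h3
  rw [this]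
  exact isClosed_eq ((mulCLM _ c1 1 b1).continuous.comp continuous_snd)
    ((mulCLM _ c2 1 b2).continuous.comp continuous_fst)

/-- The energy space as a subspace of `L² × L² × L² × L²`. -/
def Sg : Submodule ℂ Amb where
  carrier := {U | (∀ i, HasWeakDeriv i (U (some none)) (U (some (some i)))) ∧
    U none =ᵐ[volume] fun x => (‖x‖ : ℂ) * U (some none) x}
  add_mem' {U V} hU hV := by
    refine ⟨fun i => ?_, ?_⟩
    · have h1 := hU.1 i
      have h2 := hV.1 i
      simp only [HasWeakDeriv, ← Lp.toTemperedDistributionCLM_apply] at h1 h2 ⊢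
      simp only [PiLp.add_apply, map_add, LineDeriv.lineDerivOp_add, h1, h2]
    · filter_upwards [hU.2, hV.2, Lp.coeFn_add (U none) (V none),
        Lp.coeFn_add (U (some none)) (V (some none))] with x h1 h2 h3 h4
      rw [PiLp.add_apply, PiLp.add_apply, h3, h4, Pi.add_apply, Pi.add_apply, h1, h2, mul_add]
  zero_mem' := by
    refine ⟨fun i => ?_, ?_⟩
    · simp only [HasWeakDeriv, ← Lp.toTemperedDistributionCLM_apply]
      simp only [PiLp.zero_apply, map_zero]
      ext φ
      simp
    · filter_upwards [Lp.coeFn_zero ℂ 2 (volume : Measure Plane)] with x h1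
      rw [PiLp.zero_apply, h1]; simp
  smul_mem' c U hU := by
    refine ⟨fun i => ?_, ?_⟩
    · have h1 := hU.1 i
      simp only [HasWeakDeriv, ← Lp.toTemperedDistributionCLM_apply] at h1 ⊢
      simp only [PiLp.smul_apply, map_smul, LineDeriv.lineDerivOp_smul, h1]
    · filter_upwards [hU.2, Lp.coeFn_smul c (U none),
        Lp.coeFn_smul c (U (some none))] with x h1 h3 h4
      rw [PiLp.smul_apply, PiLp.smul_apply, h3, h4, Pi.smul_apply, Pi.smul_apply, h1,
        smul_eq_mul, smul_eq_mul]
      ring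

theorem mem_Sg {U : Amb} : U ∈ Sg ↔ (∀ i, HasWeakDeriv i (U (some none)) (U (some (some i)))) ∧
    U none =ᵐ[volume] fun x => (‖x‖ : ℂ) * U (some none) x := Iff.rfl

theorem isClosed_Sg : IsClosed (Sg : Set Amb) := by
  have : (Sg : Set Amb) = (⋂ i, (fun U : Amb => (U (some none), U (some (some i)))) ⁻¹'
        {p : L2 × L2 | HasWeakDeriv i p.1 p.2}) ∩ (fun U : Amb => (U (some none), U none)) ⁻¹'
        {p : L2 × L2 | p.2 =ᵐ[volume] fun x => (‖x‖ : ℂ) * p.1 x} := by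
    ext U
    simp [mem_Sg]
  rw [this]
  refine (isClosed_iInter fun i => (isClosed_hasWeakDeriv i).preimage ?_).inter
    (isClosed_mul_norm.preimage ?_) <;> fun_prop

instance : CompleteSpace Sg := isClosed_Sg.completeSpace_coe

theorem memLp_norm_mul_schwartz (ψ : 𝓢(Plane, ℂ)) :
    MemLp (fun x : Plane => (‖x‖ : ℂ) * ψ x) 2 volume := by
  have hg : Function.HasTemperateGrowth (fun x : Plane => ((1 + ‖x‖ ^ 2 : ℝ) : ℂ)) := by fun_prop
  have h := (SchwartzMap.smulLeftCLM ℂ (fun x : Plane => ((1 + ‖x‖ ^ 2 : ℝ) : ℂ)) ψ).memLp 2 volume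
  refine h.mono (by have := ψ.continuous; fun_prop) (Eventually.of_forall fun x => ?_)
  rw [SchwartzMap.smulLeftCLM_apply_apply hg, norm_mul, smul_eq_mul, norm_mul]
  refine mul_le_mul_of_nonneg_right ?_ (norm_nonneg _)
  rw [Complex.norm_real, Complex.norm_real, norm_norm, Real.norm_of_nonneg (by positivity)]
  nlinarith [sq_nonneg (‖x‖ - 1)]

/-- The components in the ambient space of a Schwartz function. -/
def sgComp (ψ : 𝓢(Plane, ℂ)) : Option (Option (Fin 2)) → L2
  | none => (memLp_norm_mul_schwartz ψ).toLp
  | some none => ψ.toLp 2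
  | some (some i) => (∂_{unitVec i} ψ).toLp 2

/-- A Schwartz function as an element of the energy space. -/
def sgOf (ψ : 𝓢(Plane, ℂ)) : Amb := WithLp.toLp 2 (sgComp ψ)

theorem sgOf_mem (ψ : 𝓢(Plane, ℂ)) : sgOf ψ ∈ Sg := by
  refine mem_Sg.2 ⟨fun i => hasWeakDeriv_toLp i ψ, ?_⟩
  filter_upwards [(memLp_norm_mul_schwartz ψ).coeFn_toLp, ψ.coeFn_toLp 2 volume] with x h1 h2
  change ((memLp_norm_mul_schwartz ψ).toLp : L2) x = (‖x‖ : ℂ) * (ψ.toLp 2 : L2) x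
  rw [h1, h2]

/-- An element of the energy space is determined by its second component. -/
theorem Sg_ext {U V : Amb} (hU : U ∈ Sg) (hV : V ∈ Sg) (h : U (some none) = V (some none)) :
    U = V := by
  ext1 j
  rcases j with _ | _ | i
  · ext1
    filter_upwards [(mem_Sg.1 hU).2, (mem_Sg.1 hV).2] with x h1 h2
    rw [h1, h2, h]
  · exact h
  · have h1 := (mem_Sg.1 hU).1 i
    rw [h] at h1
    exact h1.unique ((mem_Sg.1 hV).1 i)

section Cutoff

variable (X : 𝓢(Plane, ℂ)) (hX : HasCompactSupport X)

/-- The components of the truncation map. -/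
def cutComp : Option (Option (Fin 2)) → PiLp 2 (fun _ : Option (Fin 2) => L2) →L[ℂ] L2
  | none => (mulCLM (fun x => (‖x‖ : ℂ) * X x) (by have := X.continuous; fun_prop)
      (SchwartzMap.seminorm ℂ 1 0 X) (fun x => by
        have := SchwartzMap.norm_pow_mul_le_seminorm ℂ X 1 x
        simpa using this)).comp (PiLp.proj 2 (fun _ : Option (Fin 2) => L2) none)
  | some none => (mulS X).comp (PiLp.proj 2 (fun _ : Option (Fin 2) => L2) none)
  | some (some i) => (mulS X).comp (PiLp.proj 2 (fun _ : Option (Fin 2) => L2) (some i)) +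
      (mulS (∂_{unitVec i} X)).comp (PiLp.proj 2 (fun _ : Option (Fin 2) => L2) none)

/-- Truncation, from the graph of the gradient to the energy space. -/
def cut (W : PiLp 2 (fun _ : Option (Fin 2) => L2)) : Amb := WithLp.toLp 2 fun j => cutComp X j W

theorem continuous_cut : Continuous (cut X) := by
  unfold cut
  fun_prop

theorem cut_mem_Sg {W : PiLp 2 (fun _ : Option (Fin 2) => L2)} (hW : W ∈ gradGraph) :
    cut X W ∈ Sg := by
  refine mem_Sg.2 ⟨fun i => (hW i).mulS X, ?_⟩
  filter_upwards [coeFn_mulS X (W none), coeFn_mulCLM (fun x => (‖x‖ : ℂ) * X x)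
    (by have := X.continuous; fun_prop)
      (SchwartzMap.seminorm ℂ 1 0 X) (fun x => by
        have := SchwartzMap.norm_pow_mul_le_seminorm ℂ X 1 x
        simpa using this) (W none)] with x h1 h2
  refine h2.trans ?_
  rw [mul_assoc, ← h1]
  rfl

theorem cut_schwartzGrad (ψ : 𝓢(Plane, ℂ)) : cut X (schwartzGrad ψ) = sgOf (prodS X ψ) :=
  Sg_ext (cut_mem_Sg X (fun i => hasWeakDeriv_toLp i ψ)) (sgOf_mem _) (mulS_toLp X ψ)

-- For a fixed cutoff X the weight |x|X is bounded, so truncation is continuous from H¹ to Σ and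
-- carries Schwartz approximations in H¹ to compactly supported ones in Σ.
include hX in
theorem cut_mem_closure {W : PiLp 2 (fun _ : Option (Fin 2) => L2)} (hW : W ∈ gradGraph) :
    cut X W ∈ closure {V | ∃ ψ : 𝓢(Plane, ℂ), HasCompactSupport ψ ∧ V = sgOf ψ} := by
  refine map_mem_closure (continuous_cut X) (gradGraph_le_closure hW) ?_
  rintro _ ⟨ψ, rfl⟩
  refine ⟨prodS X ψ, ?_, cut_schwartzGrad X ψ⟩
  have e : (prodS X ψ : Plane → ℂ) = fun x => X x * ψ x := funext (prodS_apply X ψ)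
  rw [e]
  exact hX.mul_right

end Cutoff

/-- A smooth cutoff function, equal to `1` near the origin. -/
def bump : ContDiffBump (0 : Plane) := ⟨1, 2, by norm_num, by norm_num⟩

theorem hasCompactSupport_bump : HasCompactSupport fun x : Plane => ((bump x : ℝ) : ℂ) :=
  bump.hasCompactSupport.comp_left (g := Complex.ofReal) rfl

/-- The smooth cutoff function as a Schwartz function. -/
def bumpS : 𝓢(Plane, ℂ) := hasCompactSupport_bump.toSchwartzMap (by
  have := bump.contDiff (n := ⊤)
  exact Complex.ofRealCLM.contDiff.comp this)

/-- Dilation by `1 / (n + 1)`. -/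
def dil (n : ℕ) : Plane ≃L[ℝ] Plane :=
  ContinuousLinearEquiv.smulLeft (Units.mk0 ((n + 1 : ℝ)⁻¹) (by positivity))

theorem dil_apply (n : ℕ) (x : Plane) : dil n x = ((n + 1 : ℝ)⁻¹) • x := rfl

/-- The cutoff at scale `n + 1`. -/
def bumpN (n : ℕ) : 𝓢(Plane, ℂ) := SchwartzMap.compCLMOfContinuousLinearEquiv ℂ (dil n) bumpS

theorem bumpN_apply (n : ℕ) (x : Plane) : bumpN n x = ((bump (((n + 1 : ℝ)⁻¹) • x) : ℝ) : ℂ) := rfl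

theorem hasCompactSupport_bumpN (n : ℕ) : HasCompactSupport (bumpN n) :=
  hasCompactSupport_bump.comp_homeomorph (dil n).toHomeomorph

theorem norm_bumpN_le (n : ℕ) (x : Plane) : ‖bumpN n x‖ ≤ 1 := by
  rw [bumpN_apply, Complex.norm_real, Real.norm_of_nonneg bump.nonneg]
  exact bump.le_one

theorem tendsto_bumpN (x : Plane) : Tendsto (fun n => bumpN n x) atTop (𝓝 1) := by
  refine tendsto_const_nhds.congr' ?_
  filter_upwards [eventually_ge_atTop ⌈‖x‖⌉₊] with n hn
  have h1 : ‖x‖ ≤ n := Nat.ceil_le.1 hn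
  rw [bumpN_apply, bump.one_of_mem_closedBall]
  · simp
  · rw [mem_closedBall_zero_iff, norm_smul, norm_inv, Real.norm_of_nonneg (by positivity)]
    change _ ≤ (1 : ℝ)
    rw [inv_mul_le_iff₀ (by positivity)]
    linarith

theorem tendsto_mulS_bumpN (u : L2) : Tendsto (fun n => mulS (bumpN n) u) atTop (𝓝 u) := by
  rw [tendsto_iff_norm_sub_tendsto_zero]
  have h1 : Tendsto (fun n => ∫ x, ‖(bumpN n x - 1) * u x‖ ^ 2) atTop (𝓝 (∫ x : Plane, (0 : ℝ))) := by
    refine tendsto_integral_of_dominated_convergence (fun x => 4 * ‖u x‖ ^ 2) ?_ ?_ ?_ ?_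
    · intro n
      have h1 := (bumpN n).continuous
      have h2 := Lp.aestronglyMeasurable u
      exact (((h1.sub continuous_const).aestronglyMeasurable.mul h2).norm).pow 2
    · exact ((memLp_two_iff_integrable_sq_norm (Lp.aestronglyMeasurable u)).1
        (Lp.memLp u)).const_mul 4
    · refine fun n => Eventually.of_forall fun x => ?_
      rw [norm_mul, mul_pow, norm_mul, norm_pow, norm_pow, norm_norm, norm_norm]
      have h1 : ‖bumpN n x - 1‖ ≤ 2 := by
        refine (norm_sub_le _ _).trans ?_
        rw [norm_one]; linarith [norm_bumpN_le n x]
      have h2 : ‖bumpN n x - 1‖ ^ 2 ≤ 4 := by nlinarith [norm_nonneg (bumpN n x - 1)]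
      gcongr
    · refine Eventually.of_forall fun x => ?_
      have h1 : Tendsto (fun n => ‖(bumpN n x - 1) * u x‖ ^ 2) atTop
          (𝓝 (‖((1 : ℂ) - 1) * u x‖ ^ 2)) :=
        ((((tendsto_bumpN x).sub_const 1).mul_const (u x)).norm).pow 2
      simpa using h1
  have h2 : ∀ n, ‖mulS (bumpN n) u - u‖ = √(∫ x, ‖(bumpN n x - 1) * u x‖ ^ 2) := by
    intro n
    rw [eq_comm, Real.sqrt_eq_iff_eq_sq (integral_nonneg fun x => by positivity) (norm_nonneg _),
      norm_sq_eq_integral]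
    refine integral_congr_ae ?_
    filter_upwards [Lp.coeFn_sub (mulS (bumpN n) u) u, coeFn_mulS (bumpN n) u] with x h1 h2
    rw [h1, Pi.sub_apply, h2, sub_mul, one_mul]
  simp only [h2]
  simpa using h1.sqrt

theorem lineDeriv_bumpN (n : ℕ) (m x : Plane) :
    (∂_{m} (bumpN n)) x = ((n + 1 : ℝ)⁻¹ : ℂ) * (∂_{m} bumpS) (((n + 1 : ℝ)⁻¹) • x) := by
  rw [bumpN, SchwartzMap.lineDerivOp_compCLMOfContinuousLinearEquiv, dil_apply,
    LineDeriv.lineDerivOp_left_smul]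
  change (((n + 1 : ℝ)⁻¹) • ∂_{m} bumpS) (dil n x) = _
  rw [smul_apply, dil_apply, Complex.real_smul]
  push_cast
  rfl

/-- Dilation puts a factor 1/(n + 1) on the gradient of the cutoff, so the extra Leibniz term
disappears in the limit. -/
theorem tendsto_mulS_lineDeriv_bumpN (m : Plane) (u : L2) :
    Tendsto (fun n => mulS (∂_{m} (bumpN n)) u) atTop (𝓝 0) := by
  set C := SchwartzMap.seminorm ℂ 0 0 (∂_{m} bumpS)
  refine squeeze_zero_norm (a := fun n : ℕ => 1 / ((n : ℝ) + 1) * (C * ‖u‖)) (fun n => ?_) ?_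
  · rw [← mul_assoc]
    refine Lp.norm_le_mul_norm_of_ae_le_mul ?_
    filter_upwards [coeFn_mulS (∂_{m} (bumpN n)) u] with x hx
    rw [hx, norm_mul, lineDeriv_bumpN]
    refine mul_le_mul_of_nonneg_right ?_ (norm_nonneg _)
    rw [norm_mul, one_div]
    refine mul_le_mul (le_of_eq ?_) (SchwartzMap.norm_le_seminorm ℂ _ _) (norm_nonneg _)
      (by positivity)
    rw [norm_inv]
    congr 1
    rw [Complex.norm_real, Real.norm_of_nonneg (by positivity)]
  · simpa using tendsto_one_div_add_atTop_nhds_zero_nat.mul_const (C * ‖u‖)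

/-- Compactly supported smooth functions are dense in the energy space. -/
theorem Sg_subset_closure {U : Amb} (hU : U ∈ Sg) :
    U ∈ closure {V | ∃ ψ : 𝓢(Plane, ℂ), HasCompactSupport ψ ∧ V = sgOf ψ} := by
  let W : PiLp 2 (fun _ : Option (Fin 2) => L2) := WithLp.toLp 2 fun j => U (some j)
  have hW : W ∈ gradGraph := fun i => (mem_Sg.1 hU).1 i
  refine isClosed_closure.mem_of_tendsto (f := fun n => cut (bumpN n) W) (b := atTop) ?_
    (Eventually.of_forall fun n => cut_mem_closure _ (hasCompactSupport_bumpN n) hW)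
  have hc : ∀ j, Tendsto (fun n => cut (bumpN n) W j) atTop (𝓝 (U j)) := by
    intro j
    rcases j with _ | _ | i
    · refine (tendsto_mulS_bumpN (U none)).congr fun n => ?_
      ext1
      filter_upwards [coeFn_mulS (bumpN n) (U none), coeFn_mulS (bumpN n) (U (some none)),
        (mem_Sg.1 (cut_mem_Sg (bumpN n) hW)).2, (mem_Sg.1 hU).2] with x h1 h2 h3 h4
      rw [h1, h3, h4]
      change _ = (‖x‖ : ℂ) * mulS (bumpN n) (U (some none)) x
      rw [h2]
      ring
    · exact tendsto_mulS_bumpN (U (some none))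
    · have := (tendsto_mulS_bumpN (U (some (some i)))).add
        (tendsto_mulS_lineDeriv_bumpN (unitVec i) (U (some none)))
      rw [add_zero] at this
      exact this
  have h2 : Tendsto (fun n => WithLp.ofLp (cut (bumpN n) W)) atTop (𝓝 (WithLp.ofLp U)) :=
    tendsto_pi_nhds.2 hc
  have h3 := ((PiLp.continuous_toLp 2 (fun _ : Option (Option (Fin 2)) => L2)).tendsto _).comp h2
  simpa [Function.comp_def] using h3

/-- A closed property of the energy space may be checked on compactly supported functions. -/
theorem Sg_induction {p : Amb → Prop} (hp : IsClosed {U | p U})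
    (h : ∀ ψ : 𝓢(Plane, ℂ), HasCompactSupport ψ → p (sgOf ψ)) {U : Amb} (hU : U ∈ Sg) : p U := by
  have h1 : {V | ∃ ψ : 𝓢(Plane, ℂ), HasCompactSupport ψ ∧ V = sgOf ψ} ⊆ {U | p U} := by
    rintro _ ⟨ψ, hψ, rfl⟩
    exact h ψ hψ
  exact closure_minimal h1 hp (Sg_subset_closure hU)

/-! ### Ladyzhenskaya's inequality and the embedding in L⁴. -/

theorem norm_fderiv_schwartz_le (ψ : 𝓢(Plane, ℂ)) (x : Plane) :
    ‖fderiv ℝ ψ x‖ ≤ ‖(∂_{unitVec 0} ψ) x‖ + ‖(∂_{unitVec 1} ψ) x‖ := by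
  refine ContinuousLinearMap.opNorm_le_bound _ (by positivity) fun v => ?_
  have hv : v = v 0 • unitVec 0 + v 1 • unitVec 1 := by
    ext i; fin_cases i <;> simp
  conv_lhs => rw [hv]
  rw [map_add, map_smul, map_smul, ← SchwartzMap.lineDerivOp_apply_eq_fderiv,
    ← SchwartzMap.lineDerivOp_apply_eq_fderiv]
  refine (norm_add_le _ _).trans ?_
  rw [norm_smul, norm_smul, add_mul]
  have h0 := PiLp.norm_apply_le v 0
  have h1 := PiLp.norm_apply_le v 1
  refine add_le_add ?_ ?_ <;> rw [mul_comm] <;>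
    exact mul_le_mul_of_nonneg_left (by assumption) (norm_nonneg _)

theorem eLpNorm_mul_schwartz_le (ψ φ : 𝓢(Plane, ℂ)) :
    eLpNorm (fun x => ψ x * φ x) 1 volume ≤ eLpNorm ψ 2 volume * eLpNorm φ 2 volume := by
  have := eLpNorm_smul_le_mul_eLpNorm (p := 2) (q := 2) (r := 1)
    (φ.continuous.aestronglyMeasurable (μ := volume))
    (ψ.continuous.aestronglyMeasurable (μ := volume))
  exact this

theorem eLpNorm_mul_lineDeriv_le (ψ : 𝓢(Plane, ℂ)) (i : Fin 2) :
    eLpNorm (fun x => ψ x * (∂_{unitVec i} ψ) x) 1 volume ≤ ENNReal.ofReal (‖sgOf ψ‖ ^ 2) := by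
  have h1 := eLpNorm_mul_schwartz_le ψ (∂_{unitVec i} ψ)
  have h2 : ∀ φ : 𝓢(Plane, ℂ), eLpNorm φ 2 volume = ENNReal.ofReal ‖φ.toLp 2‖ := fun φ => by
    rw [SchwartzMap.norm_toLp, ENNReal.ofReal_toReal (φ.eLpNorm_lt_top 2 volume).ne]
  rw [h2, h2, ← ENNReal.ofReal_mul (norm_nonneg _)] at h1
  refine h1.trans (ENNReal.ofReal_le_ofReal ?_)
  rw [sq]
  exact mul_le_mul (PiLp.norm_apply_le (sgOf ψ) (some none))
    (PiLp.norm_apply_le (sgOf ψ) (some (some i))) (norm_nonneg _) (norm_nonneg _)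

/-- Ladyzhenskaya's inequality for compactly supported smooth functions. -/
theorem eLpNorm_four_sq_le {ψ : 𝓢(Plane, ℂ)} (hψ : HasCompactSupport ψ) :
    eLpNorm ψ 4 volume ^ 2 ≤ ENNReal.ofReal
      (4 * (eLpNormLESNormFDerivOneConst (volume : Measure Plane) 2 : ℝ) * ‖sgOf ψ‖ ^ 2) := by
  set K := eLpNormLESNormFDerivOneConst (volume : Measure Plane) 2
  have hd : Differentiable ℝ ψ := ψ.differentiable
  -- The Gagliardo–Nirenberg–Sobolev inequality from gradient in L¹ to L² is applied to ψ², whose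
  -- gradient is 2ψ∇ψ. In the constant 4, one factor 2 is this one and the other counts the partial
  -- derivatives.
  have hc : ContDiff ℝ 1 (fun x => ψ x * ψ x) := by
    have := ψ.smooth 1
    exact this.mul this
  have hs : HasCompactSupport (fun x => ψ x * ψ x) := hψ.mul_left
  have hp : NNReal.HolderConjugate (Module.finrank ℝ Plane : NNReal) 2 := by
    rw [finrank_euclideanSpace_fin]
    have := NNReal.HolderTriple.mk (p := 2) (q := 2) (r := 1)
    constructor <;> norm_num
  have h1 := eLpNorm_le_eLpNorm_fderiv_one (volume : Measure Plane) hc hs hp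
  have h2 : eLpNorm (fun x => ψ x * ψ x) ((2 : NNReal) : ENNReal) volume = eLpNorm ψ 4 volume ^ 2 := by
    have := eLpNorm_norm_rpow (μ := (volume : Measure Plane)) (p := 2) (ψ : Plane → ℂ) (q := 2)
      (by norm_num)
    have e4 : (2 : ENNReal) * ENNReal.ofReal 2 = 4 := by
      rw [ENNReal.ofReal_ofNat]; norm_num
    rw [e4, ENNReal.rpow_ofNat] at this
    rw [← this]
    refine eLpNorm_congr_norm_ae (Eventually.of_forall fun x => ?_)
    rw [norm_mul, Real.rpow_ofNat, Real.norm_of_nonneg (by positivity), sq]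
  have h3 : eLpNorm (fderiv ℝ fun x => ψ x * ψ x) 1 volume ≤
      ENNReal.ofReal (4 * ‖sgOf ψ‖ ^ 2) := by
    have h4 : ∀ᵐ x : Plane, ‖fderiv ℝ (fun x => ψ x * ψ x) x‖ ≤
        ‖(2 : ℝ) • (‖ψ x * (∂_{unitVec 0} ψ) x‖ + ‖ψ x * (∂_{unitVec 1} ψ) x‖)‖ := by
      refine Eventually.of_forall fun x => ?_
      have e : fderiv ℝ (fun x => ψ x * ψ x) x = ψ x • fderiv ℝ ψ x + ψ x • fderiv ℝ ψ x :=
        ((ψ.hasFDerivAt x).mul (ψ.hasFDerivAt x)).fderiv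
      rw [e, ← two_smul ℝ, norm_smul, norm_smul, norm_smul]
      refine mul_le_mul_of_nonneg_left ?_ (norm_nonneg _)
      rw [Real.norm_of_nonneg (by positivity), norm_mul, norm_mul, ← mul_add]
      exact mul_le_mul_of_nonneg_left (norm_fderiv_schwartz_le ψ x) (norm_nonneg _)
    refine (eLpNorm_mono_ae h4).trans ?_
    have m : ∀ i, AEStronglyMeasurable (fun x => ‖ψ x * (∂_{unitVec i} ψ) x‖) volume := fun i =>
      ((ψ.continuous.mul (∂_{unitVec i} ψ).continuous).norm).aestronglyMeasurable
    have h5 := eLpNorm_add_le (m 0) (m 1) le_rfl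
    rw [eLpNorm_norm, eLpNorm_norm] at h5
    have h6 := h5.trans (add_le_add (eLpNorm_mul_lineDeriv_le ψ 0) (eLpNorm_mul_lineDeriv_le ψ 1))
    have h7 := eLpNorm_const_smul_le (c := (2 : ℝ)) (p := 1) (μ := (volume : Measure Plane))
      (f := (fun x => ‖ψ x * (∂_{unitVec 0} ψ) x‖) + (fun x => ‖ψ x * (∂_{unitVec 1} ψ) x‖))
    refine h7.trans ((mul_le_mul_right h6 _).trans (le_of_eq ?_))
    rw [← ENNReal.ofReal_add (by positivity) (by positivity), Real.enorm_eq_ofReal (by norm_num),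
      ← ENNReal.ofReal_mul (by norm_num)]
    congr 1
    ring
  rw [h2] at h1
  refine h1.trans ((mul_le_mul_right h3 _).trans (le_of_eq ?_))
  rw [← ENNReal.ofReal_coe_nnreal, ← ENNReal.ofReal_mul (by positivity)]
  congr 1
  simp only [K]
  push_cast
  ring

/-- The embedding of the energy space in `L⁴`. -/
theorem exists_eLpNorm_four_le : ∃ C : ℝ, 0 ≤ C ∧ ∀ U ∈ Sg,
    eLpNorm (U (some none)) 4 volume ≤ ENNReal.ofReal (C * ‖U‖) := by
  set K : ℝ := NNReal.toReal (eLpNormLESNormFDerivOneConst (volume : Measure Plane) 2)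
  have hK : 0 ≤ K := NNReal.coe_nonneg _
  refine ⟨√(4 * K), by positivity, fun U hU => ?_⟩
  refine Sg_induction (p := fun U => eLpNorm (U (some none)) 4 volume ≤
    ENNReal.ofReal (√(4 * K) * ‖U‖)) ?_ ?_ hU
  · refine IsSeqClosed.isClosed fun Un U hUn hlim => ?_
    have h1 : Tendsto (fun n => Un n (some none)) atTop (𝓝 (U (some none))) :=
      ((PiLp.continuous_apply 2 (fun _ => L2) (some none)).tendsto U).comp hlim
    obtain ⟨ns, hns, hae⟩ := (tendstoInMeasure_of_tendsto_Lp h1).exists_seq_tendsto_ae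
    refine (Lp.eLpNorm_lim_le_liminf_eLpNorm (p := 4)
      (fun n => Lp.aestronglyMeasurable (Un (ns n) (some none))) _ hae).trans ?_
    have h2 : Tendsto (fun n => ENNReal.ofReal (√(4 * K) * ‖Un (ns n)‖)) atTop
        (𝓝 (ENNReal.ofReal (√(4 * K) * ‖U‖))) :=
      ENNReal.tendsto_ofReal (((hlim.comp hns.tendsto_atTop).norm).const_mul _)
    rw [← h2.liminf_eq]
    exact liminf_le_liminf (Eventually.of_forall fun n => hUn (ns n))
  · intro ψ hψ
    have h1 := eLpNorm_four_sq_le hψ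
    have e1 : eLpNorm (sgOf ψ (some none)) 4 volume = eLpNorm ψ 4 volume :=
      eLpNorm_congr_ae (ψ.coeFn_toLp 2 volume)
    rw [e1]
    have h2 : (ENNReal.ofReal (√(4 * K) * ‖sgOf ψ‖)) ^ 2 =
        ENNReal.ofReal (4 * K * ‖sgOf ψ‖ ^ 2) := by
      rw [← ENNReal.ofReal_pow (by positivity), mul_pow, Real.sq_sqrt (by positivity)]
    rw [← h2] at h1
    exact (ENNReal.pow_le_pow_left_iff two_ne_zero).1 h1

/-! ### The Gaussian as a Schwartz function. -/

theorem hasTemperateGrowth_fderiv {E F : Type*} [NormedAddCommGroup E] [NormedSpace ℝ E]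
    [NormedAddCommGroup F] [NormedSpace ℝ F] {p : E → F} (hp : p.HasTemperateGrowth) :
    Function.HasTemperateGrowth (fderiv ℝ p) := by
  refine ⟨hp.1.fderiv_right (m := ((⊤ : ℕ∞) : WithTop ℕ∞)) (by simp), fun n => ?_⟩
  obtain ⟨k, C, h⟩ := hp.2 (n + 1)
  refine ⟨k, C, fun x => ?_⟩
  rw [norm_iteratedFDeriv_fderiv]
  exact h x

/-- The real Gaussian `e^{-|x|²/2}`. -/
def gexp (x : Plane) : ℝ := Real.exp (-‖x‖ ^ 2 / 2)

theorem hasFDerivAt_gexp (x : Plane) : HasFDerivAt gexp (-(gexp x) • innerSL ℝ x) x := by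
  have h1 : HasFDerivAt (fun x : Plane => ‖x‖ ^ 2) (2 • innerSL ℝ x) x :=
    (hasStrictFDerivAt_norm_sq x).hasFDerivAt
  have h2 := ((h1.neg.mul_const ((2 : ℝ)⁻¹)).exp)
  have e : (fun x : Plane => Real.exp (-‖x‖ ^ 2 * 2⁻¹)) = gexp := by
    funext x; rw [gexp]; congr 1
  change HasFDerivAt (fun x : Plane => Real.exp (-‖x‖ ^ 2 * 2⁻¹)) _ x at h2
  rw [e] at h2
  refine h2.congr_fderiv ?_
  have e2 : Real.exp (-‖x‖ ^ 2 * 2⁻¹) = gexp x := congrFun e x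
  ext v
  have e3 : Real.exp (-(‖x‖ ^ 2 * 2⁻¹)) = gexp x := by rw [← e2, neg_mul]
  simp [e3]

theorem pow_mul_gexp_le (m : ℕ) : ∃ C, ∀ x : Plane, (1 + ‖x‖) ^ m * gexp x ≤ C := by
  -- From tᵐ ≤ m! eᵗ with t = 1 + |x|, and the maximum 3/2 of 1 + r - r²/2.
  refine ⟨m.factorial * Real.exp (3 / 2), fun x => ?_⟩
  have h1 : (1 + ‖x‖) ^ m ≤ m.factorial * Real.exp (1 + ‖x‖) := by
    have := Real.pow_div_factorial_le_exp (1 + ‖x‖) (by positivity) m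
    rw [div_le_iff₀ (by positivity)] at this
    linarith
  calc (1 + ‖x‖) ^ m * gexp x ≤ m.factorial * Real.exp (1 + ‖x‖) * gexp x :=
        mul_le_mul_of_nonneg_right h1 (Real.exp_pos _).le
    _ = m.factorial * Real.exp (1 + ‖x‖ + -‖x‖ ^ 2 / 2) := by
        rw [gexp, mul_assoc, ← Real.exp_add]
    _ ≤ _ := by
        refine mul_le_mul_of_nonneg_left (Real.exp_le_exp.2 ?_) (by positivity)
        nlinarith [sq_nonneg (‖x‖ - 1)]

/-- Differentiating e^{-|x|²/2}p gives e^{-|x|²/2}q with q again of temperate growth but with values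
in linear maps. The induction therefore quantifies over the target space and over p. -/
theorem gexp_smul_decay (n : ℕ) : ∀ {F : Type} [NormedAddCommGroup F] [NormedSpace ℝ F]
    (p : Plane → F), p.HasTemperateGrowth → ∀ k : ℕ,
    ∃ C, ∀ x, ‖x‖ ^ k * ‖iteratedFDeriv ℝ n (fun x => gexp x • p x) x‖ ≤ C := by
  induction n with
  | zero =>
    intro F _ _ p hp k
    obtain ⟨m, C, hC⟩ := hp.2 0
    obtain ⟨D, hD⟩ := pow_mul_gexp_le (k + m)
    have hC0 : 0 ≤ C := by
      have := (norm_nonneg _).trans (hC 0)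
      simpa using this
    refine ⟨C * D, fun x => ?_⟩
    have h1 := hC x
    rw [norm_iteratedFDeriv_zero] at h1 ⊢
    rw [norm_smul, Real.norm_of_nonneg (show 0 ≤ gexp x from (Real.exp_pos _).le)]
    have hx : ‖x‖ ^ k ≤ (1 + ‖x‖) ^ k := by gcongr; linarith
    have hg : 0 ≤ gexp x := (Real.exp_pos _).le
    calc ‖x‖ ^ k * (gexp x * ‖p x‖) ≤ (1 + ‖x‖) ^ k * (gexp x * (C * (1 + ‖x‖) ^ m)) := by
          gcongr
      _ = C * ((1 + ‖x‖) ^ (k + m) * gexp x) := by ring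
      _ ≤ C * D := mul_le_mul_of_nonneg_left (hD x) hC0
  | succ n ih =>
    intro F _ _ p hp k
    let q : Plane → (Plane →L[ℝ] F) := fun x =>
      fderiv ℝ p x - (ContinuousLinearMap.smulRightL ℝ Plane F) (innerSL ℝ x) (p x)
    have hq : q.HasTemperateGrowth := by
      refine (hasTemperateGrowth_fderiv hp).sub ?_
      have h1 : Function.HasTemperateGrowth (fun x : Plane => innerSL ℝ x) :=
        (innerSL ℝ : Plane →L[ℝ] _).hasTemperateGrowth
      exact (ContinuousLinearMap.smulRightL ℝ Plane F).bilinear_hasTemperateGrowth h1 hp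
    obtain ⟨C, hC⟩ := ih q hq k
    refine ⟨C, fun x => ?_⟩
    rw [← norm_iteratedFDeriv_fderiv]
    have e : fderiv ℝ (fun x => gexp x • p x) = fun x => gexp x • q x := by
      funext y
      have hpd : DifferentiableAt ℝ p y := hp.1.differentiable (by simp) y
      have e1 : (fun x => gexp x • p x) = gexp • p := rfl
      rw [e1, ((hasFDerivAt_gexp y).smul hpd.hasFDerivAt).fderiv]
      ext v
      simp only [q, add_apply, smul_apply, ContinuousLinearMap.smulRight_apply, sub_apply,
        ContinuousLinearMap.smulRightL_apply_apply, innerSL_apply_apply, smul_sub, smul_eq_mul,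
        neg_smul, neg_apply, smul_smul]
      abel
    rw [e]
    exact hC x

/-- The ground state as a Schwartz function. -/
def gaussS : 𝓢(Plane, ℂ) where
  toFun := gaussFun
  smooth' := by
    unfold gaussFun
    refine Complex.ofRealCLM.contDiff.comp (contDiff_const.mul (Real.contDiff_exp.comp ?_))
    exact (contDiff_norm_sq ℝ).neg.div_const _
  decay' k n := by
    obtain ⟨C, hC⟩ := gexp_smul_decay n (fun _ => ((1 / √Real.pi : ℝ) : ℂ))
      (Function.HasTemperateGrowth.const _) k
    refine ⟨C, fun x => ?_⟩
    have e : gaussFun = fun x => gexp x • ((1 / √Real.pi : ℝ) : ℂ) := by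
      funext y
      rw [gaussFun, gexp, Complex.real_smul, ← Complex.ofReal_mul, mul_comm]
    rw [e]
    exact hC x

theorem gaussS_apply (x : Plane) : gaussS x = gaussFun x := rfl

theorem toLp_gaussS : gaussS.toLp 2 = phi1 := rfl

theorem lineDeriv_gaussS (i : Fin 2) (x : Plane) :
    (∂_{unitVec i} gaussS) x = -((x i : ℝ) : ℂ) * gaussS x := by
  rw [SchwartzMap.lineDerivOp_apply_eq_fderiv]
  have e : (gaussS : Plane → ℂ) = fun x => gexp x • ((1 / √Real.pi : ℝ) : ℂ) := by
    funext y
    rw [gaussS_apply, gaussFun, gexp, Complex.real_smul, ← Complex.ofReal_mul, mul_comm]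
  rw [e, ((hasFDerivAt_gexp x).smul_const _).fderiv]
  simp [EuclideanSpace.inner_single_right]
  ring

/-! ### Annihilation operators and the form of the oscillator. -/

/-- Multiplication of a Schwartz function by a coordinate. -/
def mulX (i : Fin 2) (ψ : 𝓢(Plane, ℂ)) : 𝓢(Plane, ℂ) :=
  SchwartzMap.smulLeftCLM ℂ (fun x : Plane => ((x i : ℝ) : ℂ)) ψ

theorem hasTemperateGrowth_coord (i : Fin 2) :
    Function.HasTemperateGrowth (fun x : Plane => ((x i : ℝ) : ℂ)) :=
  (Complex.ofRealCLM.comp (EuclideanSpace.proj (𝕜 := ℝ) i : Plane →L[ℝ] ℝ)).hasTemperateGrowth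

theorem mulX_apply (i : Fin 2) (ψ : 𝓢(Plane, ℂ)) (x : Plane) :
    mulX i ψ x = ((x i : ℝ) : ℂ) * ψ x :=
  SchwartzMap.smulLeftCLM_apply_apply (hasTemperateGrowth_coord i) _ _

theorem lineDeriv_mulX (i : Fin 2) (ψ : 𝓢(Plane, ℂ)) :
    ∂_{unitVec i} (mulX i ψ) = ψ + mulX i (∂_{unitVec i} ψ) := by
  ext x
  have e : (mulX i ψ : Plane → ℂ) = (Complex.ofRealCLM.comp
      (EuclideanSpace.proj (𝕜 := ℝ) i : Plane →L[ℝ] ℝ) : Plane → ℂ) * ⇑ψ :=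
    funext (mulX_apply i ψ)
  rw [add_apply, mulX_apply, SchwartzMap.lineDerivOp_apply_eq_fderiv,
    SchwartzMap.lineDerivOp_apply_eq_fderiv, e,
    ((ContinuousLinearMap.hasFDerivAt _).mul (ψ.hasFDerivAt x)).fderiv]
  simp
  ring

/-- The annihilation operator `∂_i + x_i`. -/
def annih (i : Fin 2) (ψ : 𝓢(Plane, ℂ)) : 𝓢(Plane, ℂ) := ∂_{unitVec i} ψ + mulX i ψ

theorem annih_apply (i : Fin 2) (ψ : 𝓢(Plane, ℂ)) (x : Plane) :
    annih i ψ x = (∂_{unitVec i} ψ) x + ((x i : ℝ) : ℂ) * ψ x := by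
  rw [annih, add_apply, mulX_apply]

theorem annih_gaussS (i : Fin 2) : annih i gaussS = 0 := by
  ext x
  rw [annih_apply, lineDeriv_gaussS, zero_apply]
  ring

theorem inner_toLp_toLp (ψ φ : 𝓢(Plane, ℂ)) :
    inner ℂ (ψ.toLp 2 : L2) (φ.toLp 2) = ∫ x, conjSchwartz ψ x * φ x := by
  simp only [SchwartzMap.inner_toL2_toL2_eq]
  refine integral_congr_ae (Eventually.of_forall fun x => ?_)
  simp only [RCLike.inner_apply, conjSchwartz_apply]
  ring

/-- The commutator [∂ᵢ, xᵢ] = 1 in weak form. Summed over the two coordinates it turns the form of H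
+ 1 into Σᵢ‖(∂ᵢ + xᵢ)ψ‖² + 3‖ψ‖². -/
theorem inner_mulX_lineDeriv (i : Fin 2) (ψ φ : 𝓢(Plane, ℂ)) :
    inner ℂ ((mulX i ψ).toLp 2 : L2) ((∂_{unitVec i} φ).toLp 2) +
      inner ℂ ((∂_{unitVec i} ψ).toLp 2 : L2) ((mulX i φ).toLp 2) =
      - inner ℂ (ψ.toLp 2 : L2) (φ.toLp 2) := by
  simp only [inner_toLp_toLp]
  have h1 := SchwartzMap.integral_mul_lineDerivOp_right_eq_neg_left (μ := volume)
    (conjSchwartz (mulX i ψ)) φ (unitVec i)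
  have e1 : conjSchwartz (mulX i ψ) = mulX i (conjSchwartz ψ) := by
    ext x
    simp [conjSchwartz_apply, mulX_apply]
  rw [h1, e1, lineDeriv_mulX, lineDeriv_conjSchwartz]
  have i1 : Integrable (fun x => conjSchwartz ψ x * φ x) := by
    exact ((prodS (conjSchwartz ψ) φ).integrable (μ := volume)).congr
      (Eventually.of_forall fun x => prodS_apply _ _ x)
  have i2 : Integrable (fun x => conjSchwartz (∂_{unitVec i} ψ) x * mulX i φ x) := by
    exact ((prodS (conjSchwartz (∂_{unitVec i} ψ)) (mulX i φ)).integrable (μ := volume)).congr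
      (Eventually.of_forall fun x => prodS_apply _ _ x)
  have e2 : ∀ x, (conjSchwartz ψ + mulX i (conjSchwartz (∂_{unitVec i} ψ))) x * φ x =
      conjSchwartz ψ x * φ x + conjSchwartz (∂_{unitVec i} ψ) x * mulX i φ x := fun x => by
    rw [add_apply, mulX_apply, mulX_apply]; ring
  simp only [e2]
  rw [integral_add i1 i2]
  ring

theorem inner_norm_mul (ψ φ : 𝓢(Plane, ℂ)) :
    inner ℂ (sgOf ψ none) (sgOf φ none) =
      ∑ i, inner ℂ ((mulX i ψ).toLp 2 : L2) ((mulX i φ).toLp 2) := by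
  rw [L2.inner_def]
  simp only [SchwartzMap.inner_toL2_toL2_eq]
  rw [← integral_finsetSum]
  · refine integral_congr_ae ?_
    filter_upwards [(memLp_norm_mul_schwartz ψ).coeFn_toLp,
      (memLp_norm_mul_schwartz φ).coeFn_toLp] with x h1 h2
    change inner ℂ ((memLp_norm_mul_schwartz ψ).toLp _ x) ((memLp_norm_mul_schwartz φ).toLp _ x) = _
    rw [h1, h2]
    have e := EuclideanSpace.real_norm_sq_eq x
    have e' : (‖x‖ : ℂ) ^ 2 = ((x 0 : ℝ) : ℂ) ^ 2 + ((x 1 : ℝ) : ℂ) ^ 2 := by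
      rw [Fin.sum_univ_two] at e
      exact_mod_cast e
    simp only [RCLike.inner_apply, mulX_apply, Fin.sum_univ_two, map_mul, Complex.conj_ofReal]
    linear_combination (φ x * (starRingEnd ℂ) (ψ x)) * e'
  · intro i _
    have := L2.integrable_inner (𝕜 := ℂ) ((mulX i ψ).toLp 2 : L2) ((mulX i φ).toLp 2)
    refine this.congr ?_
    filter_upwards [(mulX i ψ).coeFn_toLp 2 volume, (mulX i φ).coeFn_toLp 2 volume] with x h1 h2
    rw [h1, h2]

theorem toLp_annih (i : Fin 2) (χ : 𝓢(Plane, ℂ)) :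
    (annih i χ).toLp 2 volume = (∂_{unitVec i} χ).toLp 2 volume + (mulX i χ).toLp 2 volume :=
  (SchwartzMap.toLpCLM ℂ ℂ 2 volume).map_add (∂_{unitVec i} χ) (mulX i χ)

attribute [irreducible] annih mulX

theorem inner_annih (i : Fin 2) (ψ φ : 𝓢(Plane, ℂ)) :
    inner ℂ ((annih i ψ).toLp 2 : L2) ((annih i φ).toLp 2) =
      inner ℂ ((∂_{unitVec i} ψ).toLp 2 : L2) ((∂_{unitVec i} φ).toLp 2) +
      inner ℂ ((mulX i ψ).toLp 2 : L2) ((mulX i φ).toLp 2) -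
      inner ℂ (ψ.toLp 2 : L2) (φ.toLp 2) := by
  have h1 := inner_mulX_lineDeriv i ψ φ
  have e1 := toLp_annih i ψ
  have e2 := toLp_annih i φ
  have key : ∀ a b c d e f g h : L2, a = c + d → b = e + f →
      inner ℂ d e + inner ℂ c f = - inner ℂ g h →
      inner ℂ a b = inner ℂ c e + inner ℂ d f - inner ℂ g h := by
    intro a b c d e f g h ha hb hh
    rw [ha, hb, inner_add_left, inner_add_right, inner_add_right]
    linear_combination hh
  exact key _ _ _ _ _ _ _ _ e1 e2 h1

/-- The quadratic form of the harmonic oscillator in terms of annihilation operators. -/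
theorem inner_sgOf (ψ φ : 𝓢(Plane, ℂ)) :
    inner ℂ (sgOf ψ) (sgOf φ) = ∑ i, inner ℂ ((annih i ψ).toLp 2 : L2) ((annih i φ).toLp 2) +
      3 * inner ℂ (ψ.toLp 2 : L2) (φ.toLp 2) := by
  have key : inner ℂ (sgOf ψ) (sgOf φ) = inner ℂ (sgOf ψ none) (sgOf φ none) +
      (inner ℂ (ψ.toLp 2 : L2) (φ.toLp 2) +
        ∑ i, inner ℂ ((∂_{unitVec i} ψ).toLp 2 : L2) ((∂_{unitVec i} φ).toLp 2)) := by
    rw [PiLp.inner_apply, Fintype.sum_option, Fintype.sum_option]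
    rfl
  rw [key, inner_norm_mul, Finset.sum_congr rfl fun i _ => inner_annih i ψ φ]
  simp only [Fin.sum_univ_two]
  ring

/-! ### The Gaussian Poincaré inequality by rotation of pairs. -/

theorem measurePreserving_shear_snd (s : ℝ) :
    MeasurePreserving (fun p : Plane × Plane => (p.1, p.2 + s • p.1)) := by
  have := (MeasurePreserving.id (volume : Measure Plane)).skew_product
    (μc := (volume : Measure Plane)) (μd := (volume : Measure Plane))
    (g := fun x y => y + s • x) (by fun_prop)
    (Eventually.of_forall fun x => (measurePreserving_add_right volume (s • x)).map_eq)
  exact this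

theorem measurePreserving_shear_fst (t : ℝ) :
    MeasurePreserving (fun p : Plane × Plane => (p.1 + t • p.2, p.2)) := by
  have h : MeasurePreserving (Prod.swap : Plane × Plane → Plane × Plane) := Measure.measurePreserving_swap
  exact (h.comp (measurePreserving_shear_snd t)).comp h

/-- The rotation of pairs of points. -/
def rot (θ : ℝ) (p : Plane × Plane) : Plane × Plane :=
  (Real.cos θ • p.1 + Real.sin θ • p.2, -Real.sin θ • p.1 + Real.cos θ • p.2)

/-- A rotation is a product of three shears, with parameters tan(θ/2), -sin θ, tan(θ/2); each shear
preserves the product measure by Fubini and translation invariance. -/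
theorem measurePreserving_rot {θ : ℝ} (h0 : 0 ≤ θ) (h1 : θ ≤ Real.pi / 2) :
    MeasurePreserving (rot θ) := by
  set t := Real.tan (θ / 2) with ht
  have hc : Real.cos (θ / 2) ≠ 0 :=
    (Real.cos_pos_of_mem_Ioo ⟨by linarith [Real.pi_pos], by linarith [Real.pi_pos]⟩).ne'
  have hs2 : Real.sin θ = 2 * Real.sin (θ / 2) * Real.cos (θ / 2) := by
    rw [← Real.sin_two_mul]; congr 1; ring
  have hc2 : Real.cos θ = 2 * Real.cos (θ / 2) ^ 2 - 1 := by
    rw [← Real.cos_two_mul]; congr 1; ring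
  have hsc := Real.sin_sq_add_cos_sq (θ / 2)
  have e1 : 1 - t * Real.sin θ = Real.cos θ := by
    rw [ht, Real.tan_eq_sin_div_cos, hs2, hc2]
    field_simp
    linear_combination -2 * hsc
  have e2 : t + t * Real.cos θ = Real.sin θ := by
    rw [ht, Real.tan_eq_sin_div_cos, hs2, hc2]
    field_simp
    ring
  have h := ((measurePreserving_shear_fst t).comp
    (measurePreserving_shear_snd (-Real.sin θ))).comp (measurePreserving_shear_fst t)
  convert h using 1
  funext p
  simp only [rot, Function.comp_apply, Prod.mk.injEq]
  constructor
  · match_scalars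
    · linear_combination -e1
    · linear_combination -e2 - t * e1
  · match_scalars
    · rfl
    · linear_combination -e1

theorem continuous_rot : Continuous fun q : ℝ × (Plane × Plane) => rot q.1 q.2 := by
  unfold rot
  fun_prop

theorem integral_norm_sq_schwartz (ψ : 𝓢(Plane, ℂ)) :
    ∫ x, ‖ψ x‖ ^ 2 = ‖(ψ.toLp 2 volume)‖ ^ 2 := by
  rw [norm_sq_eq_integral]
  refine integral_congr_ae ?_
  filter_upwards [ψ.coeFn_toLp 2 volume] with x hx
  rw [hx]

theorem integrable_norm_sq_schwartz (ψ : 𝓢(Plane, ℂ)) : Integrable fun x => ‖ψ x‖ ^ 2 :=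
  (memLp_two_iff_integrable_sq_norm ψ.continuous.aestronglyMeasurable).1 (ψ.memLp 2 volume)

theorem norm_phi1 : ‖phi1‖ = 1 := by
  have h1 : ‖phi1‖ ^ 2 = 1 := by
    rw [← toLp_gaussS, ← integral_norm_sq_schwartz]
    have h2 := GaussianFourier.integral_rexp_neg_mul_sq_norm (V := Plane) (b := 1) one_pos
    have h3 : ∀ x : Plane, ‖gaussS x‖ ^ 2 = Real.pi⁻¹ * Real.exp (-1 * ‖x‖ ^ 2) := fun x => by
      rw [gaussS_apply, gaussFun, Complex.norm_real, Real.norm_eq_abs, sq_abs, mul_pow, div_pow,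
        Real.sq_sqrt Real.pi_pos.le, ← Real.exp_nat_mul]
      congr 2
      · simp
      · push_cast; ring
    simp only [h3]
    rw [integral_const_mul, h2]
    simp [Real.pi_ne_zero]
  nlinarith [norm_nonneg phi1]

theorem fderiv_eq_sum_lineDeriv (χ : 𝓢(Plane, ℂ)) (x w : Plane) :
    fderiv ℝ χ x w = ∑ i, ((w i : ℝ) : ℂ) * (∂_{unitVec i} χ) x := by
  have e : w = ∑ i, w i • unitVec i := by
    ext j
    fin_cases j <;> simp
  conv_lhs => rw [e]
  rw [map_sum]
  refine Finset.sum_congr rfl fun i _ => ?_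
  rw [map_smul, SchwartzMap.lineDerivOp_apply_eq_fderiv, Complex.real_smul]

/-- The derivative of `ψ(x) φ₁(y)` along rotations of `(x, y)`. -/
def rotDeriv (ψ : 𝓢(Plane, ℂ)) (p : Plane × Plane) : ℂ :=
  ∑ i, annih i ψ p.1 * (((p.2 i : ℝ) : ℂ) * gaussS p.2)

theorem continuous_rotDeriv (ψ : 𝓢(Plane, ℂ)) : Continuous (rotDeriv ψ) := by
  unfold rotDeriv
  have h := gaussS.continuous
  have h' := fun i => (annih i ψ).continuous
  fun_prop

theorem continuous_rotDeriv_rot (ψ : 𝓢(Plane, ℂ)) (p : Plane × Plane) :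
    Continuous fun θ : ℝ => rotDeriv ψ (rot θ p) := by
  have h : Continuous fun θ : ℝ => rot θ p := by
    unfold rot
    fun_prop
  exact Continuous.comp (g := rotDeriv ψ) (continuous_rotDeriv ψ) h

/-- A rotating pair (x, y) has velocity (y, -x). As ∂ᵢφ₁ = -xᵢφ₁, differentiating the Gaussian
factor supplies the term xᵢyᵢ that completes ∂ᵢψ to (∂ᵢ + xᵢ)ψ. -/
theorem hasDerivAt_rot (ψ : 𝓢(Plane, ℂ)) (p : Plane × Plane) (θ : ℝ) :
    HasDerivAt (fun θ => ψ (rot θ p).1 * gaussS (rot θ p).2) (rotDeriv ψ (rot θ p)) θ := by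
  have h1 : HasDerivAt (fun θ => (rot θ p).1) (rot θ p).2 θ :=
    ((Real.hasDerivAt_cos θ).smul_const p.1).add ((Real.hasDerivAt_sin θ).smul_const p.2)
  have h2 : HasDerivAt (fun θ => (rot θ p).2) (-(rot θ p).1) θ := by
    refine (((Real.hasDerivAt_sin θ).neg.smul_const p.1).add
      ((Real.hasDerivAt_cos θ).smul_const p.2)).congr_deriv ?_
    simp only [rot, neg_smul, neg_add]
  have h3 := ((ψ.hasFDerivAt (rot θ p).1).comp_hasDerivAt θ h1).mul
    ((gaussS.hasFDerivAt (rot θ p).2).comp_hasDerivAt θ h2)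
  refine h3.congr_deriv ?_
  rw [fderiv_eq_sum_lineDeriv, fderiv_eq_sum_lineDeriv]
  simp only [rotDeriv, Fin.sum_univ_two, annih_apply, lineDeriv_gaussS, Function.comp_apply,
    PiLp.neg_apply, Complex.ofReal_neg]
  ring

/-- Cauchy–Schwarz on an interval. -/
theorem norm_intervalIntegral_sq_le {f : ℝ → ℂ} (hf : Continuous f) {b : ℝ} (hb : 0 < b) :
    ‖∫ t in (0 : ℝ)..b, f t‖ ^ 2 ≤ b * ∫ t in (0 : ℝ)..b, ‖f t‖ ^ 2 := by
  have h1 : ‖∫ t in (0 : ℝ)..b, f t‖ ≤ ∫ t in (0 : ℝ)..b, ‖f t‖ :=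
    intervalIntegral.norm_integral_le_integral_norm hb.le
  set m := ∫ t in (0 : ℝ)..b, ‖f t‖ with hm
  have h2 : 0 ≤ ∫ t in (0 : ℝ)..b, (b * ‖f t‖ - m) ^ 2 :=
    intervalIntegral.integral_nonneg hb.le fun _ _ => sq_nonneg _
  have e : ∫ t in (0 : ℝ)..b, (b * ‖f t‖ - m) ^ 2 =
      b ^ 2 * (∫ t in (0 : ℝ)..b, ‖f t‖ ^ 2) - 2 * b * m * m + b * m ^ 2 := by
    have e1 : ∀ t, (b * ‖f t‖ - m) ^ 2 = b ^ 2 * ‖f t‖ ^ 2 - 2 * b * m * ‖f t‖ + m ^ 2 := by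
      intro t; ring
    simp only [e1]
    rw [intervalIntegral.integral_add, intervalIntegral.integral_sub,
      intervalIntegral.integral_const_mul, intervalIntegral.integral_const_mul, ← hm,
      intervalIntegral.integral_const, sub_zero, smul_eq_mul]
    all_goals exact Continuous.intervalIntegrable (by fun_prop) _ _
  rw [e] at h2
  have h3 : 0 ≤ b * (b * (∫ t in (0 : ℝ)..b, ‖f t‖ ^ 2) - m ^ 2) := by linarith
  have h4 := (mul_nonneg_iff_of_pos_left hb).1 h3
  have h5 : ‖∫ t in (0 : ℝ)..b, f t‖ ^ 2 ≤ m ^ 2 := by gcongr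
  linarith

theorem norm_swap_sub_sq_le (ψ : 𝓢(Plane, ℂ)) (p : Plane × Plane) :
    ‖ψ p.2 * gaussS p.1 - ψ p.1 * gaussS p.2‖ ^ 2 ≤
      Real.pi / 2 * ∫ θ in (0 : ℝ)..(Real.pi / 2), ‖rotDeriv ψ (rot θ p)‖ ^ 2 := by
  have hc := continuous_rotDeriv_rot ψ p
  have h := intervalIntegral.integral_eq_sub_of_hasDerivAt
    (fun θ _ => hasDerivAt_rot ψ p θ) (hc.intervalIntegrable 0 (Real.pi / 2))
  -- The quarter turn sends (x, y) to (y, -x); evenness of φ₁ removes the sign.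
  have e : gaussS (-p.1) = gaussS p.1 := by simp [gaussS_apply, gaussFun]
  have e1 : rot 0 p = p := by simp [rot]
  have e2 : rot (Real.pi / 2) p = (p.2, -p.1) := by simp [rot]
  rw [e1, e2] at h
  simp only [e] at h
  rw [← h]
  exact norm_intervalIntegral_sq_le hc (by positivity)

theorem integrable_rotDeriv_bound (ψ : 𝓢(Plane, ℂ)) (i : Fin 2) :
    Integrable (fun p : Plane × Plane => ‖annih i ψ p.1‖ ^ 2 * ‖(‖p.2‖ : ℂ) * gaussS p.2‖ ^ 2)
      (volume.prod volume) :=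
  (integrable_norm_sq_schwartz (annih i ψ)).mul_prod
    ((memLp_two_iff_integrable_sq_norm (memLp_norm_mul_schwartz gaussS).1).1
      (memLp_norm_mul_schwartz gaussS))

theorem norm_rotDeriv_sq_le (ψ : 𝓢(Plane, ℂ)) (p : Plane × Plane) :
    ‖rotDeriv ψ p‖ ^ 2 ≤
      2 * ∑ i, ‖annih i ψ p.1‖ ^ 2 * ‖(‖p.2‖ : ℂ) * gaussS p.2‖ ^ 2 := by
  have h1 : ‖rotDeriv ψ p‖ ≤ ∑ i, ‖annih i ψ p.1‖ * ‖(‖p.2‖ : ℂ) * gaussS p.2‖ := by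
    refine (norm_sum_le _ _).trans (Finset.sum_le_sum fun i _ => ?_)
    rw [norm_mul, norm_mul, norm_mul, Complex.norm_real, Complex.norm_real, norm_norm]
    gcongr
    exact PiLp.norm_apply_le p.2 i
  simp only [Fin.sum_univ_two] at h1 ⊢
  have h2 := pow_le_pow_left₀ (norm_nonneg _) h1 2
  refine h2.trans ?_
  nlinarith [sq_nonneg (‖annih 0 ψ p.1‖ * ‖(‖p.2‖ : ℂ) * gaussS p.2‖ -
    ‖annih 1 ψ p.1‖ * ‖(‖p.2‖ : ℂ) * gaussS p.2‖)]

theorem integrable_norm_rotDeriv_sq (ψ : 𝓢(Plane, ℂ)) :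
    Integrable (fun p => ‖rotDeriv ψ p‖ ^ 2) (volume.prod volume) := by
  refine ((integrable_finsetSum Finset.univ
    fun i _ => integrable_rotDeriv_bound ψ i).const_mul 2).mono'
    (by have := continuous_rotDeriv ψ; fun_prop) (Eventually.of_forall fun p => ?_)
  rw [Real.norm_of_nonneg (by positivity)]
  exact norm_rotDeriv_sq_le ψ p

theorem integral_norm_rotDeriv_sq_le (ψ : 𝓢(Plane, ℂ)) :
    ∫ p, ‖rotDeriv ψ p‖ ^ 2 ∂(volume.prod volume) ≤
      2 * (∫ x : Plane, ‖(‖x‖ : ℂ) * gaussS x‖ ^ 2) * ∑ i, ‖(annih i ψ).toLp 2 volume‖ ^ 2 := by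
  have hi := fun i => integrable_rotDeriv_bound ψ i
  refine (integral_mono (integrable_norm_rotDeriv_sq ψ)
    ((integrable_finsetSum Finset.univ fun i _ => hi i).const_mul 2) (norm_rotDeriv_sq_le ψ)).trans ?_
  rw [integral_const_mul, integral_finsetSum Finset.univ fun i _ => hi i, Finset.mul_sum,
    Finset.mul_sum]
  refine le_of_eq (Finset.sum_congr rfl fun i _ => ?_)
  rw [integral_prod_mul (fun x => ‖annih i ψ x‖ ^ 2) (fun x : Plane => ‖(‖x‖ : ℂ) * gaussS x‖ ^ 2),
    integral_norm_sq_schwartz]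
  ring

/-- Tonelli, then invariance of the measure under each rotation. One factor π/2 comes from
Cauchy–Schwarz in θ, the other from the length of the interval. -/
theorem lintegral_swap_sub_le (ψ : 𝓢(Plane, ℂ)) :
    ∫⁻ p, ENNReal.ofReal (‖ψ p.2 * gaussS p.1 - ψ p.1 * gaussS p.2‖ ^ 2)
        ∂((volume : Measure Plane).prod (volume : Measure Plane)) ≤
      ENNReal.ofReal ((Real.pi / 2) ^ 2) *
        ∫⁻ p, ENNReal.ofReal (‖rotDeriv ψ p‖ ^ 2) ∂(volume.prod volume) := by
  have hpi : 0 ≤ Real.pi / 2 := by positivity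
  have hJ : Measurable fun q : ℝ × (Plane × Plane) =>
      ENNReal.ofReal (‖rotDeriv ψ (rot q.1 q.2)‖ ^ 2) := by
    have h : Continuous fun q : ℝ × (Plane × Plane) => rotDeriv ψ (rot q.1 q.2) :=
      Continuous.comp (g := rotDeriv ψ) (continuous_rotDeriv ψ) continuous_rot
    exact ENNReal.measurable_ofReal.comp (h.norm.pow 2).measurable
  have h1 : ∀ p, ENNReal.ofReal (‖ψ p.2 * gaussS p.1 - ψ p.1 * gaussS p.2‖ ^ 2) ≤
      ENNReal.ofReal (Real.pi / 2) * ∫⁻ θ in Ioc 0 (Real.pi / 2),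
        ENNReal.ofReal (‖rotDeriv ψ (rot θ p)‖ ^ 2) := fun p => by
    have hc : Continuous fun θ : ℝ => ‖rotDeriv ψ (rot θ p)‖ ^ 2 :=
      (continuous_rotDeriv_rot ψ p).norm.pow 2
    rw [← ofReal_integral_eq_lintegral_ofReal, ← ENNReal.ofReal_mul hpi,
      ← intervalIntegral.integral_of_le hpi]
    · exact ENNReal.ofReal_le_ofReal (norm_swap_sub_sq_le ψ p)
    · exact (hc.intervalIntegrable 0 (Real.pi / 2)).1
    · exact Eventually.of_forall fun _ => sq_nonneg _
  refine (lintegral_mono h1).trans ?_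
  rw [lintegral_const_mul' _ _ ENNReal.ofReal_ne_top, lintegral_lintegral_swap]
  · have h2 : ∀ θ ∈ Ioc 0 (Real.pi / 2), ∫⁻ p, ENNReal.ofReal (‖rotDeriv ψ (rot θ p)‖ ^ 2)
        ∂(volume.prod volume) =
        ∫⁻ p, ENNReal.ofReal (‖rotDeriv ψ p‖ ^ 2) ∂(volume.prod volume) := fun θ hθ => by
      refine (measurePreserving_rot hθ.1.le hθ.2).lintegral_comp
        (f := fun p => ENNReal.ofReal (‖rotDeriv ψ p‖ ^ 2)) ?_
      exact ENNReal.measurable_ofReal.comp ((continuous_rotDeriv ψ).norm.pow 2).measurable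
    rw [setLIntegral_congr_fun measurableSet_Ioc h2, setLIntegral_const, Real.volume_Ioc, sub_zero,
      mul_comm _ (ENNReal.ofReal (Real.pi / 2)), ← mul_assoc, ← ENNReal.ofReal_mul hpi, sq]
  · exact (hJ.comp measurable_swap).aemeasurable

/-- Expanding the square, the cross term factors over x and y into |(ψ, φ₁)|², and ‖φ₁‖ = 1. The
antisymmetrised product thus measures the distance of ψ from the line of φ₁. -/
theorem integrable_swap_sub (ψ : 𝓢(Plane, ℂ)) :
    Integrable (fun p : Plane × Plane => ‖ψ p.2 * gaussS p.1 - ψ p.1 * gaussS p.2‖ ^ 2)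
        (volume.prod volume) ∧
      ∫ p : Plane × Plane, ‖ψ p.2 * gaussS p.1 - ψ p.1 * gaussS p.2‖ ^ 2 ∂(volume.prod volume) =
        2 * (‖ψ.toLp 2 volume‖ ^ 2 - ‖(inner ℂ phi1 (ψ.toLp 2 volume) : ℂ)‖ ^ 2) := by
  have i1 : Integrable (fun p : Plane × Plane => ‖gaussS p.1‖ ^ 2 * ‖ψ p.2‖ ^ 2)
      (volume.prod volume) :=
    (integrable_norm_sq_schwartz gaussS).mul_prod (integrable_norm_sq_schwartz ψ)
  have i2 : Integrable (fun p : Plane × Plane => ‖ψ p.1‖ ^ 2 * ‖gaussS p.2‖ ^ 2)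
      (volume.prod volume) :=
    (integrable_norm_sq_schwartz ψ).mul_prod (integrable_norm_sq_schwartz gaussS)
  have i3 : Integrable (fun p : Plane × Plane =>
      (conjSchwartz ψ p.1 * gaussS p.1) * (conjSchwartz gaussS p.2 * ψ p.2))
      (volume.prod volume) := by
    refine Integrable.mul_prod (f := fun x => conjSchwartz ψ x * gaussS x)
      (g := fun x => conjSchwartz gaussS x * ψ x) ?_ ?_
    · exact ((prodS (conjSchwartz ψ) gaussS).integrable (μ := volume)).congr
        (Eventually.of_forall fun x => prodS_apply _ _ x)
    · exact ((prodS (conjSchwartz gaussS) ψ).integrable (μ := volume)).congr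
        (Eventually.of_forall fun x => prodS_apply _ _ x)
  have e : (fun p : Plane × Plane => ‖ψ p.2 * gaussS p.1 - ψ p.1 * gaussS p.2‖ ^ 2) =
      fun p => ‖gaussS p.1‖ ^ 2 * ‖ψ p.2‖ ^ 2 + ‖ψ p.1‖ ^ 2 * ‖gaussS p.2‖ ^ 2 -
        2 * RCLike.re ((conjSchwartz ψ p.1 * gaussS p.1) * (conjSchwartz gaussS p.2 * ψ p.2)) := by
    funext p
    simp only [conjSchwartz_apply]
    have h := Complex.normSq_sub (ψ p.2 * gaussS p.1) (ψ p.1 * gaussS p.2)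
    simp only [Complex.normSq_eq_norm_sq, map_mul] at h
    rw [h]
    have e3 : ψ p.2 * gaussS p.1 * ((starRingEnd ℂ) (ψ p.1) * (starRingEnd ℂ) (gaussS p.2)) =
      (starRingEnd ℂ) (ψ p.1) * gaussS p.1 * ((starRingEnd ℂ) (gaussS p.2) * ψ p.2) := by ring
    rw [e3]
    simp only [RCLike.re_eq_complex_re]
    ring
  rw [e]
  refine ⟨(i1.add i2).sub (i3.re.const_mul 2), ?_⟩
  have i4 := i1.add i2
  simp only [Pi.add_def] at i4
  rw [integral_sub i4 (i3.re.const_mul 2), integral_add i1 i2, integral_const_mul,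
    integral_re i3,
    integral_prod_mul (fun x => conjSchwartz ψ x * gaussS x) (fun x => conjSchwartz gaussS x * ψ x),
    integral_prod_mul (fun x => ‖gaussS x‖ ^ 2) (fun x => ‖ψ x‖ ^ 2),
    integral_prod_mul (fun x => ‖ψ x‖ ^ 2) (fun x => ‖gaussS x‖ ^ 2), integral_norm_sq_schwartz,
    integral_norm_sq_schwartz, toLp_gaussS, norm_phi1, ← inner_toLp_toLp, ← inner_toLp_toLp,
    toLp_gaussS, ← inner_conj_symm, RCLike.conj_mul]
  have : RCLike.re (((‖(inner ℂ phi1 (ψ.toLp 2 volume) : ℂ)‖ : ℂ)) ^ 2) =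
      ‖(inner ℂ phi1 (ψ.toLp 2 volume) : ℂ)‖ ^ 2 := by
    rw [← Complex.ofReal_pow, RCLike.re_eq_complex_re, Complex.ofReal_re]
  erw [this]
  ring

/-- The Gaussian Poincaré inequality, in the ground state representation. -/
theorem exists_norm_sq_sub_inner_sq_le : ∃ C, 0 ≤ C ∧ ∀ ψ : 𝓢(Plane, ℂ),
    ‖ψ.toLp 2 volume‖ ^ 2 - ‖(inner ℂ phi1 (ψ.toLp 2 volume) : ℂ)‖ ^ 2 ≤
      C * ∑ i, ‖(annih i ψ).toLp 2 volume‖ ^ 2 := by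
  refine ⟨(Real.pi / 2) ^ 2 * (∫ x : Plane, ‖(‖x‖ : ℂ) * gaussS x‖ ^ 2), by positivity,
    fun ψ => ?_⟩
  have h1 := lintegral_swap_sub_le ψ
  have h2 := integral_norm_rotDeriv_sq_le ψ
  obtain ⟨h3, h4⟩ := integrable_swap_sub ψ
  rw [← ofReal_integral_eq_lintegral_ofReal h3 (Eventually.of_forall fun _ => sq_nonneg _),
    ← ofReal_integral_eq_lintegral_ofReal (integrable_norm_rotDeriv_sq ψ)
      (Eventually.of_forall fun _ => sq_nonneg _), ← ENNReal.ofReal_mul (by positivity),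
    ENNReal.ofReal_le_ofReal_iff (by positivity), h4] at h1
  have h5 := mul_le_mul_of_nonneg_left h2 (by positivity : 0 ≤ (Real.pi / 2) ^ 2)
  linarith

/-! ### Ground state and spectral gap on the energy space. -/

theorem inner_phi1_self : (inner ℂ phi1 phi1 : ℂ) = 1 := by
  rw [inner_self_eq_norm_sq_to_K, norm_phi1]; simp

/-- The ground state, as an element of the energy space. -/
def ground : Amb := sgOf gaussS

theorem toLp_zero_schwartz : (0 : 𝓢(Plane, ℂ)).toLp 2 volume = 0 :=
  (SchwartzMap.toLpCLM ℂ ℂ 2 volume).map_zero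

/-- The weak form of (H + 1)φ₁ = 3φ₁: the annihilation operators kill φ₁. It also makes
orthogonality to φ₁ in Σ the same as in L². -/
theorem inner_ground {U : Amb} (hU : U ∈ Sg) :
    inner ℂ ground U = 3 * (inner ℂ phi1 (U (some none)) : ℂ) := by
  refine Sg_induction (p := fun U => inner ℂ ground U = 3 * (inner ℂ phi1 (U (some none)) : ℂ))
    ?_ ?_ hU
  · exact isClosed_eq (by fun_prop) (by fun_prop)
  · intro ψ _
    rw [ground, inner_sgOf]
    have : ∀ i, inner ℂ ((annih i gaussS).toLp 2 volume) ((annih i ψ).toLp 2 volume) = (0 : ℂ) := by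
      intro i
      rw [annih_gaussS, toLp_zero_schwartz, inner_zero_left]
    rw [Finset.sum_eq_zero fun i _ => this i, zero_add]
    rfl

theorem norm_sgOf_sq (ψ : 𝓢(Plane, ℂ)) : ‖sgOf ψ‖ ^ 2 =
    ∑ i, ‖(annih i ψ).toLp 2 volume‖ ^ 2 + 3 * ‖ψ.toLp 2 volume‖ ^ 2 := by
  have h := congrArg RCLike.re (inner_sgOf ψ ψ)
  rw [inner_self_eq_norm_sq, map_add, map_sum] at h
  simp only [inner_self_eq_norm_sq] at h
  rw [h]
  congr 1
  rw [inner_self_eq_norm_sq_to_K, RCLike.re_eq_complex_re]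
  change (3 * ((‖ψ.toLp 2 volume‖ : ℝ) : ℂ) ^ 2).re = _
  rw [← Complex.ofReal_pow, show (3 : ℂ) = ((3 : ℝ) : ℂ) by norm_num, ← Complex.ofReal_mul]
  exact Complex.ofReal_re _

theorem three_mul_norm_sq_le {U : Amb} (hU : U ∈ Sg) : 3 * ‖U (some none)‖ ^ 2 ≤ ‖U‖ ^ 2 := by
  refine Sg_induction (p := fun U => 3 * ‖U (some none)‖ ^ 2 ≤ ‖U‖ ^ 2) ?_ ?_ hU
  · exact isClosed_le (by fun_prop) (by fun_prop)
  · intro ψ _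
    rw [norm_sgOf_sq]
    have : 0 ≤ ∑ i, ‖(annih i ψ).toLp 2 volume‖ ^ 2 := by positivity
    change 3 * ‖ψ.toLp 2 volume‖ ^ 2 ≤ _
    linarith

/-- The spectral gap above the ground state of the harmonic oscillator. -/
theorem exists_spectral_gap : ∃ C, 0 ≤ C ∧ ∀ U ∈ Sg,
    ‖U (some none)‖ ^ 2 - ‖(inner ℂ phi1 (U (some none)) : ℂ)‖ ^ 2 ≤
      C * (‖U‖ ^ 2 - 3 * ‖U (some none)‖ ^ 2) := by
  obtain ⟨C, hC, h⟩ := exists_norm_sq_sub_inner_sq_le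
  refine ⟨C, hC, fun U hU => ?_⟩
  refine Sg_induction (p := fun U => ‖U (some none)‖ ^ 2 -
    ‖(inner ℂ phi1 (U (some none)) : ℂ)‖ ^ 2 ≤ C * (‖U‖ ^ 2 - 3 * ‖U (some none)‖ ^ 2)) ?_ ?_ hU
  · exact isClosed_le (by fun_prop) (by fun_prop)
  · intro ψ _
    rw [norm_sgOf_sq, add_sub_assoc]
    change ‖ψ.toLp 2 volume‖ ^ 2 - ‖(inner ℂ phi1 (ψ.toLp 2 volume) : ℂ)‖ ^ 2 ≤
      C * (∑ i, ‖(annih i ψ).toLp 2 volume‖ ^ 2 +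
        (3 * ‖ψ.toLp 2 volume‖ ^ 2 - 3 * ‖ψ.toLp 2 volume‖ ^ 2))
    rw [sub_self, add_zero]
    exact h ψ

-- The cubic term on the energy space.

local instance : ENNReal.HolderTriple 4 4 2 := ⟨by
  rw [← two_mul, show (4 : ENNReal) = 2 * 2 by norm_num, ENNReal.mul_inv (by simp) (by simp),
    ← mul_assoc, ENNReal.mul_inv_cancel (by simp) (by simp), one_mul]⟩

/-- Hölder's inequality with four factors. -/
theorem integrable_and_norm_integral_le_of_four {F : Plane → ℂ} {f g h k : Plane → ℝ}
    {a b c d : ℝ} (hF : AEStronglyMeasurable F volume) (hf : AEStronglyMeasurable f volume)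
    (hg : AEStronglyMeasurable g volume) (hh : AEStronglyMeasurable h volume)
    (hk : AEStronglyMeasurable k volume) (hb : 0 ≤ b) (hc : 0 ≤ c) (hd : 0 ≤ d)
    (ha : 0 ≤ a) (ef : eLpNorm f 4 volume ≤ ENNReal.ofReal a)
    (eg : eLpNorm g 4 volume ≤ ENNReal.ofReal b) (eh : eLpNorm h 4 volume ≤ ENNReal.ofReal c)
    (ek : eLpNorm k 4 volume ≤ ENNReal.ofReal d)
    (hle : ∀ᵐ x, ‖F x‖ ≤ f x * g x * (h x * k x)) :
    Integrable F ∧ ‖∫ x, F x‖ ≤ a * b * (c * d) := by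
  have h1 : eLpNorm F 1 volume ≤ ENNReal.ofReal (a * b * (c * d)) := by
    calc eLpNorm F 1 volume ≤ eLpNorm ((f • g) • (h • k)) 1 volume := by
          refine eLpNorm_mono_ae ?_
          filter_upwards [hle] with x hx
          exact hx.trans (le_abs_self _)
      _ ≤ eLpNorm (f • g) 2 volume * eLpNorm (h • k) 2 volume :=
          eLpNorm_smul_le_mul_eLpNorm (hh.smul hk) (hf.smul hg)
      _ ≤ (eLpNorm f 4 volume * eLpNorm g 4 volume) * (eLpNorm h 4 volume * eLpNorm k 4 volume) :=
          mul_le_mul' (eLpNorm_smul_le_mul_eLpNorm hg hf) (eLpNorm_smul_le_mul_eLpNorm hk hh)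
      _ ≤ (ENNReal.ofReal a * ENNReal.ofReal b) * (ENNReal.ofReal c * ENNReal.ofReal d) := by
          gcongr
      _ = _ := by
          rw [← ENNReal.ofReal_mul ha, ← ENNReal.ofReal_mul hc, ← ENNReal.ofReal_mul (by positivity)]
  have hi : Integrable F := memLp_one_iff_integrable.1 ⟨hF, h1.trans_lt ENNReal.ofReal_lt_top⟩
  refine ⟨hi, (norm_integral_le_integral_norm F).trans ?_⟩
  rw [eLpNorm_one_eq_lintegral_enorm, ← ofReal_integral_norm_eq_lintegral_enorm hi,
    ENNReal.ofReal_le_ofReal_iff (by positivity)] at h1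
  exact h1

/-- The function underlying an element of the energy space. -/
def toFn : Sg →L[ℂ] L2 :=
  (PiLp.proj 2 (fun _ : Option (Option (Fin 2)) => L2) (some none)).comp Sg.subtypeL

/-- A constant in the Sobolev inequality for the energy space. -/
def sobC : ℝ := exists_eLpNorm_four_le.choose

theorem sobC_nonneg : 0 ≤ sobC := exists_eLpNorm_four_le.choose_spec.1

theorem eLpNorm_toFn_le (w : Sg) : eLpNorm (toFn w) 4 volume ≤ ENNReal.ofReal (sobC * ‖w‖) :=
  exists_eLpNorm_four_le.choose_spec.2 w w.2

theorem aesm (u : L2) : AEStronglyMeasurable u volume := Lp.aestronglyMeasurable u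

/-- The cubic nonlinearity `|u|² u`. -/
def cube (u : ℂ) : ℂ := (‖u‖ : ℂ) ^ 2 * u

theorem continuous_cube : Continuous cube := by unfold cube; fun_prop

theorem norm_cube (u : ℂ) : ‖cube u‖ = ‖u‖ ^ 3 := by
  rw [cube, norm_mul, norm_pow, Complex.norm_real, norm_norm]; ring

theorem norm_cube_sub_le (u v : ℂ) : ‖cube u - cube v‖ ≤ (‖u‖ + ‖v‖) ^ 2 * ‖u - v‖ := by
  have e : cube u - cube v = (‖u‖ : ℂ) ^ 2 * (u - v) +
      (((‖u‖ - ‖v‖) * (‖u‖ + ‖v‖) : ℝ) : ℂ) * v := by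
    rw [cube, cube]; push_cast; ring
  have h1 : |‖u‖ - ‖v‖| ≤ ‖u - v‖ := abs_norm_sub_norm_le u v
  rw [e]
  refine (norm_add_le _ _).trans ?_
  rw [norm_mul, norm_mul, norm_pow, Complex.norm_real, Complex.norm_real, norm_norm,
    Real.norm_eq_abs, abs_mul, abs_of_nonneg (by positivity : 0 ≤ ‖u‖ + ‖v‖)]
  have h2 : |‖u‖ - ‖v‖| * (‖u‖ + ‖v‖) * ‖v‖ ≤ ‖u - v‖ * (‖u‖ + ‖v‖) * ‖v‖ := by gcongr
  have h3 : 0 ≤ ‖u - v‖ * (‖u‖ * ‖v‖) := by positivity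
  nlinarith

theorem integrable_cube_mul (w v : Sg) :
    Integrable (fun x => (starRingEnd ℂ) (cube (toFn w x)) * toFn v x) ∧
    ‖∫ x, (starRingEnd ℂ) (cube (toFn w x)) * toFn v x‖ ≤
      (sobC * ‖w‖) * (sobC * ‖w‖) * ((sobC * ‖w‖) * (sobC * ‖v‖)) := by
  have hC := sobC_nonneg
  have hw := aesm (toFn w)
  have hv := aesm (toFn v)
  refine integrable_and_norm_integral_le_of_four (f := fun x => ‖toFn w x‖)
    (g := fun x => ‖toFn w x‖) (h := fun x => ‖toFn w x‖) (k := fun x => ‖toFn v x‖)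
    ?_ hw.norm hw.norm hw.norm hv.norm (by positivity) (by positivity) (by positivity)
    (by positivity) ?_ ?_ ?_ ?_ (Eventually.of_forall fun x => le_of_eq ?_)
  · exact ((Complex.continuous_conj.comp continuous_cube).comp_aestronglyMeasurable hw).mul hv
  · rw [eLpNorm_norm]; exact eLpNorm_toFn_le w
  · rw [eLpNorm_norm]; exact eLpNorm_toFn_le w
  · rw [eLpNorm_norm]; exact eLpNorm_toFn_le w
  · rw [eLpNorm_norm]; exact eLpNorm_toFn_le v
  · rw [norm_mul, RCLike.norm_conj, norm_cube]; ring

/-- The cubic term as a functional. -/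
def cubeForm (w : Sg) : StrongDual ℂ Sg :=
  LinearMap.mkContinuous
    { toFun := fun v => ∫ x, (starRingEnd ℂ) (cube (toFn w x)) * toFn v x
      map_add' := fun v v' => by
        rw [← integral_add (integrable_cube_mul w v).1 (integrable_cube_mul w v').1, map_add]
        refine integral_congr_ae ?_
        filter_upwards [Lp.coeFn_add (toFn v) (toFn v')] with x hx
        rw [hx, Pi.add_apply, mul_add]
      map_smul' := fun c v => by
        rw [RingHom.id_apply, smul_eq_mul, ← integral_const_mul, map_smul]
        refine integral_congr_ae ?_
        filter_upwards [Lp.coeFn_smul c (toFn v)] with x hx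
        rw [hx, Pi.smul_apply, smul_eq_mul]
        ring }
    ((sobC * ‖w‖) * (sobC * ‖w‖) * (sobC * ‖w‖) * sobC) (fun v => by
      refine (integrable_cube_mul w v).2.trans (le_of_eq ?_)
      ring)

theorem cubeForm_apply (w v : Sg) :
    cubeForm w v = ∫ x, (starRingEnd ℂ) (cube (toFn w x)) * toFn v x := rfl

theorem norm_cubeForm_sub_le (w w' : Sg) :
    ‖cubeForm w - cubeForm w'‖ ≤ sobC ^ 4 * (‖w‖ + ‖w'‖) ^ 2 * ‖w - w'‖ := by
  have hC := sobC_nonneg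
  refine ContinuousLinearMap.opNorm_le_bound _ (by positivity) fun v => ?_
  rw [sub_apply, cubeForm_apply, cubeForm_apply,
    ← integral_sub (integrable_cube_mul w v).1 (integrable_cube_mul w' v).1]
  have hw := aesm (toFn w)
  have hw' := aesm (toFn w')
  have hv := aesm (toFn v)
  have hs : eLpNorm (fun x => ‖toFn w x‖ + ‖toFn w' x‖) 4 volume ≤
      ENNReal.ofReal (sobC * (‖w‖ + ‖w'‖)) := by
    refine (eLpNorm_add_le (p := 4) hw.norm hw'.norm (by norm_num)).trans ?_
    rw [eLpNorm_norm, eLpNorm_norm, mul_add, ENNReal.ofReal_add (by positivity) (by positivity)]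
    exact add_le_add (eLpNorm_toFn_le w) (eLpNorm_toFn_le w')
  have key := (integrable_and_norm_integral_le_of_four
    (F := fun x => (starRingEnd ℂ) (cube (toFn w x)) * toFn v x -
      (starRingEnd ℂ) (cube (toFn w' x)) * toFn v x)
    (f := fun x => ‖toFn w x‖ + ‖toFn w' x‖) (g := fun x => ‖toFn w x‖ + ‖toFn w' x‖)
    (h := fun x => ‖toFn (w - w') x‖) (k := fun x => ‖toFn v x‖)
    (a := sobC * (‖w‖ + ‖w'‖)) (b := sobC * (‖w‖ + ‖w'‖)) (c := sobC * ‖w - w'‖)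
    (d := sobC * ‖v‖)
    ((integrable_cube_mul w v).1.sub (integrable_cube_mul w' v).1).1 (hw.norm.add hw'.norm)
    (hw.norm.add hw'.norm) (aesm _).norm hv.norm (by positivity) (by positivity) (by positivity)
    (by positivity) hs hs ?_ ?_ ?_).2
  · refine key.trans (le_of_eq ?_)
    ring
  · rw [eLpNorm_norm]; exact eLpNorm_toFn_le _
  · rw [eLpNorm_norm]; exact eLpNorm_toFn_le _
  · rw [map_sub]
    filter_upwards [Lp.coeFn_sub (toFn w) (toFn w')] with x hx
    rw [hx, Pi.sub_apply, ← sub_mul, ← map_sub, norm_mul, RCLike.norm_conj, ← mul_assoc]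
    refine mul_le_mul_of_nonneg_right ?_ (norm_nonneg _)
    rw [← sq]
    exact norm_cube_sub_le _ _

/-- The cubic nonlinearity of the energy space, by Riesz representation. -/
def cubeN (w : Sg) : Sg := (InnerProductSpace.toDual ℂ Sg).symm (cubeForm w)

theorem inner_cubeN_left (w v : Sg) :
    inner ℂ (cubeN w) v = ∫ x, (starRingEnd ℂ) (cube (toFn w x)) * toFn v x :=
  InnerProductSpace.toDual_symm_apply

theorem inner_cubeN_right (v w : Sg) :
    inner ℂ v (cubeN w) = ∫ x, cube (toFn w x) * (starRingEnd ℂ) (toFn v x) := by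
  rw [← inner_conj_symm v (cubeN w), inner_cubeN_left, ← integral_conj]
  refine integral_congr_ae (Eventually.of_forall fun x => ?_)
  simp

theorem norm_cubeN_sub_le (w w' : Sg) :
    ‖cubeN w - cubeN w'‖ ≤ sobC ^ 4 * (‖w‖ + ‖w'‖) ^ 2 * ‖w - w'‖ := by
  rw [cubeN, cubeN, ← LinearIsometryEquiv.map_sub, LinearIsometryEquiv.norm_map]
  exact norm_cubeForm_sub_le w w'

theorem cubeN_smul (c : ℂ) (w : Sg) : cubeN (c • w) = ((‖c‖ ^ 2 : ℝ) : ℂ) • c • cubeN w := by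
  refine ext_inner_right ℂ fun v => ?_
  rw [inner_smul_left (c • cubeN w) v, inner_smul_left (cubeN w) v, inner_cubeN_left, inner_cubeN_left, ← integral_const_mul,
    ← integral_const_mul, map_smul]
  refine integral_congr_ae ?_
  filter_upwards [Lp.coeFn_smul c (toFn w)] with x hx
  rw [hx, Pi.smul_apply, cube, cube, smul_eq_mul, norm_mul]
  simp only [map_mul, map_pow, Complex.conj_ofReal, Complex.ofReal_mul, Complex.ofReal_pow]
  ring

theorem integrable_norm_pow_four (w : Sg) : Integrable fun x => ‖toFn w x‖ ^ 4 := by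
  refine (integrable_cube_mul w w).1.norm.congr (Eventually.of_forall fun x => ?_)
  simp only [norm_mul, RCLike.norm_conj, norm_cube]
  ring

theorem inner_cubeN_self (w : Sg) : inner ℂ w (cubeN w) = ((∫ x, ‖toFn w x‖ ^ 4 : ℝ) : ℂ) := by
  rw [inner_cubeN_right, ← integral_complex_ofReal]
  refine integral_congr_ae (Eventually.of_forall fun x => ?_)
  simp only [cube]
  rw [mul_assoc, Complex.mul_conj, Complex.normSq_eq_norm_sq]
  push_cast
  ring

/-! ### The mass operator and verification of the abstract hypotheses. -/

/-- The embedding of `L²` in the dual of the energy space, as an operator. -/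
def massK : Sg →L[ℂ] Sg := toFn.adjoint.comp toFn

theorem inner_massK_right (v w : Sg) : inner ℂ v (massK w) = (inner ℂ (toFn v) (toFn w) : ℂ) :=
  ContinuousLinearMap.adjoint_inner_right toFn v (toFn w)

theorem inner_massK_left (v w : Sg) : inner ℂ (massK v) w = (inner ℂ (toFn v) (toFn w) : ℂ) :=
  ContinuousLinearMap.adjoint_inner_left toFn w (toFn v)

theorem re_inner_massK_self (w : Sg) : (inner ℂ w (massK w) : ℂ).re = ‖toFn w‖ ^ 2 := by
  rw [inner_massK_right]
  exact inner_self_eq_norm_sq (𝕜 := ℂ) (toFn w)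

/-- The ground state. -/
def groundSg : Sg := ⟨ground, sgOf_mem gaussS⟩

theorem toFn_groundSg : toFn groundSg = phi1 := rfl

theorem inner_groundSg (v : Sg) : inner ℂ groundSg v = 3 * (inner ℂ phi1 (toFn v) : ℂ) :=
  inner_ground v.2

theorem integral_norm_sq_mul_le (w : Sg) :
    Integrable (fun x => ‖x‖ ^ 2 * ‖toFn w x‖ ^ 2) ∧
      ∫ x, ‖x‖ ^ 2 * ‖toFn w x‖ ^ 2 = ‖(w : Amb) none‖ ^ 2 := by
  have e : (fun x => ‖(w : Amb) none x‖ ^ 2) =ᵐ[volume] fun x => ‖x‖ ^ 2 * ‖toFn w x‖ ^ 2 := by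
    filter_upwards [(mem_Sg.1 w.2).2] with x hx
    rw [hx, norm_mul, Complex.norm_real, norm_norm, mul_pow]
    rfl
  refine ⟨((memLp_two_iff_integrable_sq_norm (aesm _)).1 (Lp.memLp _)).congr e, ?_⟩
  rw [norm_sq_eq_integral, integral_congr_ae e]

theorem norm_none_le (w : Sg) : ‖(w : Amb) none‖ ^ 2 ≤ ‖w‖ ^ 2 :=
  pow_le_pow_left₀ (norm_nonneg _) (PiLp.norm_apply_le (w : Amb) none) 2

/-- Mass is controlled by the `L⁴` norm when the energy is controlled by the mass. -/
theorem norm_toFn_pow_four_le (w : Sg) (h : ‖w‖ ^ 2 ≤ 4 * ‖toFn w‖ ^ 2) :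
    (‖toFn w‖ ^ 2) ^ 2 ≤
      4 * volume.real (Metric.closedBall (0 : Plane) 3) * ∫ x, ‖toFn w x‖ ^ 4 := by
  set B := Metric.closedBall (0 : Plane) 3 with hB
  set b := volume.real B with hb
  set q := ∫ x, ‖toFn w x‖ ^ 4 with hq
  set m := ‖toFn w‖ ^ 2 with hm
  have hq0 : 0 ≤ q := integral_nonneg fun _ => by positivity
  have hBfin : volume B ≠ ⊤ := measure_closedBall_lt_top.ne
  have hbpos : 0 < b := by
    refine ENNReal.toReal_pos ?_ hBfin
    exact (Metric.measure_closedBall_pos volume _ (by norm_num)).ne'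
  rcases (sq_nonneg ‖toFn w‖).eq_or_lt with h0 | h0
  · rw [← hm] at h0
    rw [← h0, zero_pow two_ne_zero]
    positivity
  rw [← hm] at h0
  -- The parameter of Young's inequality on the ball, taken so that the constant term λb of the
  -- integrated bound absorbs half of the mass.
  set lam := m / (2 * b) with hlam
  have hl : 0 < lam := by positivity
  obtain ⟨i2, e2⟩ := integral_norm_sq_mul_le w
  have i1 := integrable_norm_pow_four w
  have i3 : Integrable (B.indicator fun _ : Plane => (1 : ℝ)) :=
    (integrable_indicator_iff Metric.isClosed_closedBall.measurableSet).2
      (integrableOn_const hBfin)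
  have i0 : Integrable fun x => ‖toFn w x‖ ^ 2 :=
    (memLp_two_iff_integrable_sq_norm (aesm _)).1 (Lp.memLp _)
  -- Young's inequality inside the ball of radius 3; outside, |x|² ≥ 8. Since ‖xw‖² ≤ ‖w‖² ≤ 4m, the
  -- last term integrates to at most m/2.
  have hp : ∀ x, ‖toFn w x‖ ^ 2 ≤ (lam / 2 * B.indicator (fun _ => (1 : ℝ)) x +
      1 / (2 * lam) * ‖toFn w x‖ ^ 4) + 1 / 8 * (‖x‖ ^ 2 * ‖toFn w x‖ ^ 2) := by
    intro x
    by_cases hx : x ∈ B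
    · rw [indicator_of_mem hx]
      have : ‖toFn w x‖ ^ 2 ≤ lam / 2 * 1 + 1 / (2 * lam) * ‖toFn w x‖ ^ 4 := by
        have h1 : 0 ≤ (lam - ‖toFn w x‖ ^ 2) ^ 2 / (2 * lam) := by positivity
        have h2 : (lam - ‖toFn w x‖ ^ 2) ^ 2 / (2 * lam) =
            lam / 2 * 1 + 1 / (2 * lam) * ‖toFn w x‖ ^ 4 - ‖toFn w x‖ ^ 2 := by
          field_simp
          ring
        linarith
      have : 0 ≤ 1 / 8 * (‖x‖ ^ 2 * ‖toFn w x‖ ^ 2) := by positivity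
      linarith
    · rw [indicator_of_notMem hx]
      have h3 : 3 < ‖x‖ := by
        rw [hB, mem_closedBall_zero_iff, not_le] at hx
        exact hx
      have h4 : 8 ≤ ‖x‖ ^ 2 := by nlinarith
      have : 0 ≤ 1 / (2 * lam) * ‖toFn w x‖ ^ 4 := by positivity
      have := mul_le_mul_of_nonneg_right h4 (sq_nonneg ‖toFn w x‖)
      linarith
  have h5 := integral_mono i0 (((i3.const_mul (lam / 2)).add (i1.const_mul (1 / (2 * lam)))).add
    (i2.const_mul (1 / 8))) hp
  have i4 := (i3.const_mul (lam / 2)).add (i1.const_mul (1 / (2 * lam)))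
  simp only [Pi.add_def] at i4 h5
  rw [integral_add i4 (i2.const_mul _), integral_add (i3.const_mul _) (i1.const_mul _),
    integral_const_mul, integral_const_mul, integral_const_mul, e2, ← norm_sq_eq_integral, ← hm,
    ← hq, integral_indicator Metric.isClosed_closedBall.measurableSet, setIntegral_const, ← hb] at h5
  have h6 := norm_none_le w
  have h7 : m ≤ lam * b + q / lam := by
    have e : 1 / (2 * lam) * q = q / lam / 2 := by field_simp
    rw [e, smul_eq_mul] at h5
    linarith
  have e8 : lam * b = m / 2 := by rw [hlam]; field_simp
  have e9 : q / lam = 2 * b * q / m := by rw [hlam]; field_simp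
  rw [e8, e9] at h7
  have h10 : m / 2 ≤ 2 * b * q / m := by linarith
  rw [le_div_iff₀ h0] at h10
  nlinarith

theorem exists_cubicBifurcation : ∃ δ C, CubicBifurcation massK cubeN groundSg δ C := by
  obtain ⟨C₁, hC₁, gap⟩ := exists_spectral_gap
  have hC := sobC_nonneg
  set C₂ := 4 * volume.real (Metric.closedBall (0 : Plane) 3) with hC₂
  have hC₂0 : 0 ≤ C₂ := by positivity
  have hq : ∀ w : Sg, 0 ≤ ∫ x, ‖toFn w x‖ ^ 4 := fun w => integral_nonneg fun _ => by positivity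
  -- With g = ‖v‖² - 3‖v‖₂² and p = |(φ₁, v)|, the gap gives ‖v‖² ≤ (1 + 3C₁)g + 3p², while the
  -- coercive form is g + 9p².
  refine ⟨1 / (1 + 3 * C₁), sobC ^ 4 + C₂, ?_⟩
  refine
    { symm := fun u v => by rw [inner_massK_left, inner_massK_right]
      map_e := ?_
      inner_e := by rw [inner_groundSg, toFn_groundSg, inner_phi1_self, mul_one]
      delta_pos := by positivity
      coercive := fun v => ?_
      le_norm_sq := fun v => by
        rw [re_inner_massK_self]
        exact three_mul_norm_sq_le v.2
      C_nonneg := by positivity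
      cubic_smul := cubeN_smul
      cubic_lip := fun w w' => (norm_cubeN_sub_le w w').trans (by
        gcongr
        linarith)
      cubic_self_im := fun w => by rw [inner_cubeN_self, Complex.ofReal_im]
      cubic_self_nonneg := fun w => by rw [inner_cubeN_self, Complex.ofReal_re]; exact hq w
      cubic_e_pos := ?_
      apriori := fun w hw => ?_ }
  · refine ext_inner_left ℂ fun v => ?_
    rw [inner_smul_right, inner_massK_right, toFn_groundSg, ← inner_conj_symm v groundSg,
      inner_groundSg, map_mul, inner_conj_symm, Complex.conj_ofNat]
  · have h1 := gap v v.2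
    rw [re_inner_massK_self, inner_groundSg, norm_mul, div_mul_eq_mul_div, one_mul,
      div_le_iff₀ (by positivity)]
    have h2 : 3 * ‖toFn v‖ ^ 2 ≤ ‖v‖ ^ 2 := three_mul_norm_sq_le v.2
    change ‖toFn v‖ ^ 2 - ‖(inner ℂ phi1 (toFn v) : ℂ)‖ ^ 2 ≤
      C₁ * (‖v‖ ^ 2 - 3 * ‖toFn v‖ ^ 2) at h1
    set p := ‖(inner ℂ phi1 (toFn v) : ℂ)‖
    have e3 : ‖(3 : ℂ)‖ = 3 := by simp
    rw [e3]
    nlinarith [sq_nonneg p, mul_nonneg hC₁ (sq_nonneg p)]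
  -- The mass bound applied to φ₁, with ‖φ₁‖² = 3 in Σ and mass 1, rules out a vanishing L⁴ norm.
  · have h1 := norm_toFn_pow_four_le groundSg (by
      have h := inner_groundSg groundSg
      rw [toFn_groundSg, inner_phi1_self, mul_one] at h
      have h2 := inner_self_eq_norm_sq (𝕜 := ℂ) groundSg
      rw [h] at h2
      rw [← h2, toFn_groundSg, norm_phi1]
      simp
      norm_num)
    rw [toFn_groundSg, norm_phi1] at h1
    rw [inner_cubeN_self, Complex.ofReal_re]
    refine (hq _).lt_of_ne fun h0 => ?_
    rw [toFn_groundSg] at h0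
    rw [← h0] at h1
    norm_num at h1
  · rw [re_inner_massK_self] at hw ⊢
    rw [inner_cubeN_self, Complex.ofReal_re]
    refine (norm_toFn_pow_four_le w hw).trans ?_
    have := hq w
    gcongr
    have : 0 ≤ sobC ^ 4 := by positivity
    linarith

/-! ### Back to functions in L² and the weak equation. -/

theorem toFn_injective : Function.Injective toFn := fun U V h => Subtype.ext (Sg_ext U.2 V.2 h)

theorem weakDeriv_toFn (U : Sg) (i : Fin 2) : weakDeriv i (toFn U) = (U : Amb) (some (some i)) :=
  HasWeakDeriv.weakDeriv_eq ((mem_Sg.1 U.2).1 i)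

theorem memSigma_toFn (U : Sg) : MemSigma (toFn U) :=
  ⟨fun i => ⟨_, (mem_Sg.1 U.2).1 i⟩, (memLp_congr_ae (mem_Sg.1 U.2).2).1 (Lp.memLp _)⟩

theorem exists_toFn_eq {u : L2} (h : MemSigma u) : ∃ U : Sg, toFn U = u := by
  obtain ⟨h1, h2⟩ := h
  choose g hg using h1
  let f : Option (Option (Fin 2)) → L2 := fun j =>
    j.elim h2.toLp fun k => k.elim u g
  exact ⟨⟨WithLp.toLp 2 f, mem_Sg.2 ⟨hg, h2.coeFn_toLp⟩⟩, rfl⟩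

theorem scalar_eq_inner (u v : L2) : scalar u v = inner ℂ v u := by
  rw [L2.inner_def, scalar]
  rfl

theorem sigmaNorm_toFn (U : Sg) : sigmaNorm (toFn U) = ‖U‖ := by
  have h0 : ∫ x : Plane, (1 + ‖x‖ ^ 2) * ‖toFn U x‖ ^ 2 = ‖toFn U‖ ^ 2 + ‖(U : Amb) none‖ ^ 2 := by
    obtain ⟨i2, e2⟩ := integral_norm_sq_mul_le U
    have i0 : Integrable fun x => ‖toFn U x‖ ^ 2 :=
      (memLp_two_iff_integrable_sq_norm (aesm _)).1 (Lp.memLp _)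
    rw [← e2, norm_sq_eq_integral, ← integral_add i0 i2]
    refine integral_congr_ae (Eventually.of_forall fun x => ?_)
    simp only
    ring
  have h1 : ‖U‖ ^ 2 = ‖(U : Amb) none‖ ^ 2 + (‖toFn U‖ ^ 2 +
      ∑ i, ‖(U : Amb) (some (some i))‖ ^ 2) := by
    rw [Submodule.coe_norm, PiLp.norm_sq_eq_of_L2, Fintype.sum_option, Fintype.sum_option]
    rfl
  rw [sigmaNorm, Finset.sum_congr rfl fun i _ => by rw [weakDeriv_toFn U i], h0,
    Real.sqrt_eq_iff_eq_sq (by positivity) (norm_nonneg _), h1]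
  ring

/-- The inner product of Σ carries one more L² pairing than the form of H; this is the shift from
eigenvalue 2 to 3. -/
theorem energy_form_eq (Q v : Sg) :
    ∑ i, scalar (weakDeriv i (toFn Q)) (weakDeriv i (toFn v)) +
      ∫ x : Plane, (‖x‖ : ℂ) ^ 2 * toFn Q x * star (toFn v x) =
      inner ℂ v Q - inner ℂ (toFn v) (toFn Q) := by
  have h0 : ∫ x : Plane, (‖x‖ : ℂ) ^ 2 * toFn Q x * star (toFn v x) =
      inner ℂ ((v : Amb) none) ((Q : Amb) none) := by
    rw [L2.inner_def]
    refine integral_congr_ae ?_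
    filter_upwards [(mem_Sg.1 Q.2).2, (mem_Sg.1 v.2).2] with x h1 h2
    rw [h1, h2, RCLike.inner_apply, map_mul, Complex.conj_ofReal]
    change _ = (‖x‖ : ℂ) * toFn Q x * ((‖x‖ : ℂ) * star (toFn v x))
    ring
  have h1 : inner ℂ v Q = inner ℂ ((v : Amb) none) ((Q : Amb) none) +
      (inner ℂ (toFn v) (toFn Q) +
        ∑ i, inner ℂ ((v : Amb) (some (some i))) ((Q : Amb) (some (some i))) : ℂ) := by
    rw [Submodule.coe_inner, PiLp.inner_apply, Fintype.sum_option, Fintype.sum_option]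
    rfl
  rw [h0, h1, Finset.sum_congr rfl fun i _ => by
    rw [weakDeriv_toFn, weakDeriv_toFn, scalar_eq_inner]]
  ring

/-- Test functions in Σ are exactly the vectors of the Hilbert space, so the weak equation is an
identity between Riesz representatives. -/
theorem isStationarySol_toFn_iff (η : ℝ) (Q : Sg) : IsStationarySol (2 + η) (toFn Q) ↔
    Q ≠ 0 ∧ Q - (3 : ℂ) • massK Q = (η : ℂ) • massK Q - cubeN Q := by
  have key : ∀ v : Sg, (((2 + η : ℝ) : ℂ) * scalar (toFn Q) (toFn v) =
      ∑ i, scalar (weakDeriv i (toFn Q)) (weakDeriv i (toFn v)) +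
      (∫ x : Plane, (‖x‖ : ℂ) ^ 2 * toFn Q x * star (toFn v x)) +
      ∫ x : Plane, (‖toFn Q x‖ : ℂ) ^ 2 * toFn Q x * star (toFn v x)) ↔
      inner ℂ v (Q - (3 : ℂ) • massK Q) = (inner ℂ v ((η : ℂ) • massK Q - cubeN Q) : ℂ) := by
    intro v
    have h2 : ∫ x : Plane, (‖toFn Q x‖ : ℂ) ^ 2 * toFn Q x * star (toFn v x) =
        inner ℂ v (cubeN Q) := (inner_cubeN_right v Q).symm
    rw [energy_form_eq, h2, scalar_eq_inner, inner_sub_right, inner_sub_right,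
      inner_smul_right v (massK Q), inner_smul_right v (massK Q), inner_massK_right]
    push_cast
    constructor
    · intro h
      linear_combination -h
    · intro h
      linear_combination -h
  constructor
  · rintro ⟨-, h1, h2⟩
    refine ⟨fun h => h1 (by rw [h, map_zero]), ext_inner_left ℂ fun v => ?_⟩
    exact (key v).1 (h2 _ (memSigma_toFn v))
  · rintro ⟨h1, h2⟩
    refine ⟨memSigma_toFn Q, fun h => h1 (toFn_injective (by rw [h, map_zero])), fun v hv => ?_⟩
    obtain ⟨v, rfl⟩ := exists_toFn_eq hv
    exact (key v).2 (by rw [h2])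

end

theorem proposition3 :
    ∃ η₀ : ℝ, 0 < η₀ ∧ ∃ (u : ℝ → L2) (μ : ℝ → ℝ) (a : ℝ → ℝ) (z : ℝ → L2),
      (∀ η ∈ Ioo 0 η₀,
        μ η = 2 + η ∧ 2 < μ η ∧
        IsStationarySol (μ η) (u η) ∧
        u η = ((√η : ℝ) : ℂ) • ((a η : ℂ) • phi1 + z η) ∧
        ∀ Q : L2, IsStationarySol (μ η) Q → ∃ c : ℂ, ‖c‖ = 1 ∧ Q = c • u η) ∧
      z 0 = 0 ∧
      (∀ η ∈ Ico 0 η₀, 0 < a η ∧ MemSigma (z η) ∧ scalar (z η) phi1 = 0) ∧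
      ContinuousOn a (Ico 0 η₀) ∧
      ∀ η ∈ Ico 0 η₀,
        Tendsto (fun s => sigmaNorm (z s - z η)) (𝓝[Ico 0 η₀] η) (𝓝 0) := by
  obtain ⟨δ, C, h⟩ := exists_cubicBifurcation
  obtain ⟨η₀, hη₀, α, ξ, hξ0, hα, hξ, hpos, hsol⟩ := h.exists_branch
  have hu : ∀ η, ((√η : ℝ) : ℂ) • ((α η : ℂ) • phi1 + toFn ((α η : ℂ) • ξ η)) =
      toFn (((√η * α η : ℝ) : ℂ) • (groundSg + ξ η)) := by
    intro η
    rw [map_smul, map_smul, map_add, toFn_groundSg, ← smul_add, smul_smul, Complex.ofReal_mul]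
  -- From u = √η·α(φ₁ + ξ), the profile is a = α and z = αξ, so z inherits orthogonality, continuity
  -- and z(0) = 0 from ξ.
  refine ⟨η₀, hη₀, fun η => ((√η : ℝ) : ℂ) • ((α η : ℂ) • phi1 + toFn ((α η : ℂ) • ξ η)),
    fun η => 2 + η, α, fun η => toFn ((α η : ℂ) • ξ η), fun η hη => ?_, ?_, fun η hη => ?_, hα,
    fun η hη => ?_⟩
  · obtain ⟨h1, h2⟩ := hsol η hη
    refine ⟨rfl, by simpa using hη.1, ?_, rfl, fun Q hQ => ?_⟩
    · simp only [hu]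
      exact (isStationarySol_toFn_iff _ _).2 (h1 _ rfl)
    · simp only [hu]
      obtain ⟨Q, rfl⟩ := exists_toFn_eq hQ.1
      obtain ⟨h3, h4⟩ := (isStationarySol_toFn_iff _ _).1 hQ
      obtain ⟨c, hc, rfl⟩ := h2 Q h3 h4
      exact ⟨c, hc, by rw [map_smul]⟩
  · simp only [hξ0, smul_zero, map_zero]
  · refine ⟨(hpos η hη).1, memSigma_toFn _, ?_⟩
    have h1 := inner_groundSg ((α η : ℂ) • ξ η)
    rw [inner_smul_right groundSg (ξ η), (hpos η hη).2, mul_zero] at h1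
    rw [scalar_eq_inner]
    exact (mul_eq_zero.1 h1.symm).resolve_left three_ne_zero
  · have hc : ContinuousOn (fun η => (α η : ℂ) • ξ η) (Ico 0 η₀) :=
      (Complex.continuous_ofReal.comp_continuousOn hα).smul hξ
    simp only [← map_sub, sigmaNorm_toFn]
    exact tendsto_iff_norm_sub_tendsto_zero.1 (hc η hη)
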